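/- Let $M$ be a smooth $2$-manifold and let $d\sigma^2=\langle\cdot,\cdot\rangle$ be a smooth positive semi-definite metric on $M$, that is, a smooth field of symmetric positive semi-definite bilinear forms on the tangent spaces. The null space at $q\in M$ is $\mathcal N_q=\{v\in T_qM \mid \langle v,w\rangle=0 \text{ for all } w\in T_qM\}$, and $q$ is a singular point if $\mathcal N_q\neq 0$. For smooth vector fields $X,Y,Z$ put $$\Gamma(X,Y,Z)=\tfrac12\bigl(X\langle Y,Z\rangle+Y\langle Z,X\rangle-Z\langle X,Y\rangle+\langle[X,Y],Z\rangle-\langle[Y,Z],X\rangle+\langle[Z,X],Y\rangle\bigr).$$ Assume that $d\sigma^2$ is admissible: at every singular point $q$, $\Gamma(X,Y,Z)(q)=0$ for all smooth vector fields $X,Y,Z$ around $q$ with $Z_q\in\mathcal N_q$. Let $p\in M$ be an intrinsic cross cap singularity, that is, a singular point such that, for a local coordinate system $(u,v)$ around $p$ in which $d\sigma^2=E\,du^2+2F\,du\,dv+G\,dv^2$, the function $\lambda=EG-F^2$ satisfies $\lambda_{uu}\lambda_{vv}-\lambda_{uv}^2\neq0$ at $p$ (this does not depend on the coordinate system). Let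 $\varepsilon>0$ and let $\gamma:[0,\varepsilon)\to M$ be a smooth curve with $\gamma(0)=p$ and $\dot\gamma(t)\neq0$ for all $t\in[0,\varepsilon)$; whether $\dot\gamma(0)$ is transversal to $\mathcal N_p$ or contained in it is left open. Let $R$ be the set of all $t\in(0,\varepsilon)$ such that $\gamma(t)$ is not a singular point, let $n$ be a continuous unit normal field along $\gamma|_R$ (so $\langle n,n\rangle=1$ and $\langle n,\dot\gamma\rangle=0$), and for $t\in R$ let $$\kappa_g(t)=\frac{\langle\nabla_{\dot\gamma(t)}\dot\gamma(t),n(t)\rangle}{|\dot\gamma(t)|^2},\qquad ds=|\dot\gamma(t)|\,dt,\qquad |\xi|=\sqrt{\langle\xi,\xi\rangle},$$ where $\nabla$ is the Levi-Civita connection of $d\sigma^2$ on the set of non-singular points. Then all sufficiently small $t>0$ belong to $R$, and the geodesic curvature measure $\kappa_g\,ds$ extends to a continuous $1$-form on $\{0\}\cup R$: there is a continuous function $f:\{0\}\cup R\to\mathbb R$ with $f(t)=\kappa_g(t)\,|\dot\gamma(t)|$ for all $t\in R$. In particular, if $\gamma$ meets no singular point at times $t\in(0,\varepsilon)$, then $\kappa_g\,ds$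 is a continuous $1$-form on $[0,\varepsilon)$. -/

import Mathlib

open Set Filter Topology Manifold Bundle
open scoped ContDiff

noncomputable section

/-- The model plane of two-dimensional manifolds. -/
abbrev Plane : Type := EuclideanSpace ℝ (Fin 2)

/-- A (smooth) positive semi-definite metric on a 2-manifold: a smooth field of symmetric positive
semi-definite bilinear forms on the tangent spaces. -/
structure PosSemidefMetric (M : Type*) [TopologicalSpace M] [ChartedSpace Plane M]
    [IsManifold (𝓡 2) ∞ M] where
  /-- the bilinear form on each tangent space -/
  form (q : M) : TangentSpace (𝓡 2) q →L[ℝ] TangentSpace (𝓡 2) q →L[ℝ] ℝ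
  symm (q : M) (v w : TangentSpace (𝓡 2) q) : form q v w = form q w v
  nonneg (q : M) (v : TangentSpace (𝓡 2) q) : 0 ≤ form q v v
  contMDiff : ContMDiff (𝓡 2) ((𝓡 2).prod 𝓘(ℝ, Plane →L[ℝ] Plane →L[ℝ] ℝ)) ∞
    (fun q ↦ TotalSpace.mk' (Plane →L[ℝ] Plane →L[ℝ] ℝ)
      (E := fun q : M ↦ TangentSpace (𝓡 2) q →L[ℝ] TangentSpace (𝓡 2) q →L[ℝ] ℝ) q (form q))

namespace PosSemidefMetric

variable {M : Type*} [TopologicalSpace M] [ChartedSpace Plane M] [IsManifold (𝓡 2) ∞ M]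

/-- The null space of the metric at a point. -/
def nullSpace (g : PosSemidefMetric M) (q : M) : Set (TangentSpace (𝓡 2) q) :=
  {v | ∀ w : TangentSpace (𝓡 2) q, g.form q v w = 0}

/-- A point is singular if the bilinear form is degenerate there. -/
def IsSingular (g : PosSemidefMetric M) (q : M) : Prop :=
  ∃ v ∈ g.nullSpace q, v ≠ 0

/-- The derivative at `q` of the function `⟨Y, Z⟩` in the direction `X`. -/
def dirDeriv (g : PosSemidefMetric M) (X Y Z : Π q : M, TangentSpace (𝓡 2) q) (q : M) : ℝ :=
  mfderiv (𝓡 2) 𝓘(ℝ, ℝ) (fun x ↦ g.form x (Y x) (Z x)) q (X q)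

/-- The Kossowski pseudo-connection. -/
def kossowski (g : PosSemidefMetric M) (X Y Z : Π q : M, TangentSpace (𝓡 2) q) (q : M) : ℝ :=
  (1 / 2) * (g.dirDeriv X Y Z q + g.dirDeriv Y Z X q - g.dirDeriv Z X Y q
    + g.form q (VectorField.mlieBracket (𝓡 2) X Y q) (Z q)
    - g.form q (VectorField.mlieBracket (𝓡 2) Y Z q) (X q)
    + g.form q (VectorField.mlieBracket (𝓡 2) Z X q) (Y q))

/-- A vector field that is smooth around the point `q`. -/
def SmoothFieldAt (X : Π q : M, TangentSpace (𝓡 2) q) (q : M) : Prop :=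
  ContMDiffAt (𝓡 2) ((𝓡 2).prod 𝓘(ℝ, Plane)) ∞
    (fun x ↦ (TotalSpace.mk' Plane x (X x) : TangentBundle (𝓡 2) M)) q

/-- The pseudo-connection vanishes at `q` whenever its last argument is a null vector at `q`.
Its value depends only on the germs of the vector fields at `q`, hence these are only required to
be smooth around `q`. -/
def AdmissibleAt (g : PosSemidefMetric M) (q : M) : Prop :=
  ∀ X Y Z : Π q : M, TangentSpace (𝓡 2) q,
    SmoothFieldAt X q → SmoothFieldAt Y q → SmoothFieldAt Z q →
      Z q ∈ g.nullSpace q → g.kossowski X Y Z q = 0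

/-- An admissible metric: all singular points are admissible. -/
def Admissible (g : PosSemidefMetric M) : Prop :=
  ∀ q : M, g.IsSingular q → g.AdmissibleAt q

/-- The coordinate vector field `∂/∂xⁱ` of the chart `φ`, at the point with coordinates `x`. -/
def coordField (φ : OpenPartialHomeomorph M Plane) (x : Plane) (i : Fin 2) :
    TangentSpace (𝓡 2) (φ.symm x) :=
  mfderiv 𝓘(ℝ, Plane) (𝓡 2) φ.symm x (EuclideanSpace.single i (1 : ℝ) : Plane)

/-- The coefficients `(E, F; F, G)` of the metric in the chart `φ`, as functions of the
coordinates. -/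
def coeff (g : PosSemidefMetric M) (φ : OpenPartialHomeomorph M Plane) (x : Plane) :
    Matrix (Fin 2) (Fin 2) ℝ :=
  Matrix.of fun i j ↦ g.form (φ.symm x) (coordField φ x i) (coordField φ x j)

/-- Partial derivative of a function on the plane. -/
def pd (i : Fin 2) (f : Plane → ℝ) (x : Plane) : ℝ :=
  fderiv ℝ f x (EuclideanSpace.single i (1 : ℝ))

/-- `λ = E G - F²` in the chart `φ`. -/
def gramDet (g : PosSemidefMetric M) (φ : OpenPartialHomeomorph M Plane) (x : Plane) : ℝ :=
  (g.coeff φ x).det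

/-- An intrinsic cross cap singularity: a singular point at which the Hessian determinant of
`λ`, computed in a local coordinate system around it, does not vanish (this does not depend on the
coordinate system). -/
def IsIntrinsicCrossCap (g : PosSemidefMetric M) (p : M) : Prop :=
  g.IsSingular p ∧ ∃ φ ∈ IsManifold.maximalAtlas (𝓡 2) ∞ M, p ∈ φ.source ∧
    (Matrix.of fun i j : Fin 2 ↦ pd i (pd j (g.gramDet φ)) (φ p)).det ≠ 0

/-- Christoffel symbols `Γᵏᵢⱼ` of the Levi-Civita connection in the chart `φ` (at points where the
metric is nondegenerate). -/
def christoffel (g : PosSemidefMetric M) (φ : OpenPartialHomeomorph M Plane) (i j k : Fin 2)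
    (x : Plane) : ℝ :=
  (1 / 2) * ∑ l, (g.coeff φ x)⁻¹ k l *
    (pd i (fun y ↦ g.coeff φ y j l) x + pd j (fun y ↦ g.coeff φ y i l) x
      - pd l (fun y ↦ g.coeff φ y i j) x)

/-- The velocity `γ'(t)` of a curve defined on the interval `J`. -/
def velocity (γ : ℝ → M) (J : Set ℝ) (t : ℝ) : TangentSpace (𝓡 2) (γ t) :=
  mfderivWithin 𝓘(ℝ, ℝ) (𝓡 2) γ J t (1 : ℝ)

/-- The `k`-th component `ẍᵏ + Γᵏᵢⱼ ẋⁱ ẋʲ` of the covariant acceleration in the chart `φ`, where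
`x = φ ∘ γ`. -/
def accelComponent (g : PosSemidefMetric M) (γ : ℝ → M) (J : Set ℝ)
    (φ : OpenPartialHomeomorph M Plane) (k : Fin 2) (t : ℝ) : ℝ :=
  derivWithin (derivWithin (fun s ↦ φ (γ s) k) J) J t
    + ∑ i, ∑ j, g.christoffel φ i j k (φ (γ t)) *
      derivWithin (fun s ↦ φ (γ s) i) J t * derivWithin (fun s ↦ φ (γ s) j) J t

/-- `⟨∇_{γ'} γ', n⟩` at time `t`, for the Levi-Civita connection `∇` and a tangent vector `n` at
`γ t`, computed in the preferred chart `φ` at `γ t`: the sum over `k` of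
`(∇_{γ'} γ')ᵏ ⟨∂/∂xᵏ, n⟩`. The coordinate vectors `∂/∂xᵏ` live at `φ.symm (φ (γ t))`, which is
`γ t`; the components of `n` are those of its image under the differential of `φ`. -/
def accelInner (g : PosSemidefMetric M) (γ : ℝ → M) (J : Set ℝ) (t : ℝ)
    (n : TangentSpace (𝓡 2) (γ t)) : ℝ :=
  let φ := chartAt Plane (γ t)
  let ν : Plane := mfderiv (𝓡 2) 𝓘(ℝ, Plane) φ (γ t) n
  ∑ k, ∑ l, g.coeff φ (φ (γ t)) k l * g.accelComponent γ J φ k t * ν l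

/-- The speed `|γ'(t)|`, so that `ds = |γ'(t)| dt`. -/
def speed (g : PosSemidefMetric M) (γ : ℝ → M) (J : Set ℝ) (t : ℝ) : ℝ :=
  √(g.form (γ t) (velocity γ J t) (velocity γ J t))

/-- The geodesic curvature `⟨∇_{γ'} γ', n⟩ / |γ'|²` with respect to the unit normal field `n`. -/
def geodesicCurvature (g : PosSemidefMetric M) (γ : ℝ → M) (J : Set ℝ)
    (n : Π t : ℝ, TangentSpace (𝓡 2) (γ t)) (t : ℝ) : ℝ :=
  g.accelInner γ J t (n t) / g.speed γ J t ^ 2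

/-- The times `t ∈ (0, ε)` at which `γ t` is not a singular point. -/
def regularTimes (g : PosSemidefMetric M) (γ : ℝ → M) (ε : ℝ) : Set ℝ :=
  {t | t ∈ Ioo 0 ε ∧ ¬ g.IsSingular (γ t)}

/-- `n` is a continuous field, along `γ` over the times in `T`, of unit vectors orthogonal
to `γ'`; here `γ` is defined on `J`. -/
structure IsUnitNormalOn (g : PosSemidefMetric M) (γ : ℝ → M) (J : Set ℝ)
    (n : Π t : ℝ, TangentSpace (𝓡 2) (γ t)) (T : Set ℝ) : Prop where
  continuousOn : ContinuousOn
    (fun t ↦ (TotalSpace.mk' Plane (γ t) (n t) : TangentBundle (𝓡 2) M)) T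
  unit : ∀ t ∈ T, g.form (γ t) (n t) (n t) = 1
  orthogonal : ∀ t ∈ T, g.form (γ t) (n t) (velocity γ J t) = 0

end PosSemidefMetric

end

noncomputable section

/-! ### One-sided limits -/

/-! Work in a chart around `p` and let λ be the determinant of the metric there. As λ ≥ 0 vanishes
at `p` with nondegenerate Hessian, the Hessian is positive definite (`fderiv_fderiv_pos`). So λ
vanishes along γ exactly to second order at t = 0 (`gramDet_curve_derivWithin`): γ(t) is nonsingular
for small t > 0, and √λ is t times a function with a positive limit. The null space at `p` is a
line: if the metric vanished at `p`, admissibility would kill the first derivatives of its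
coefficients, and λ would be o(s²) along a line (`exists_chartForm_pos`).

Fix constant vectors e, f in the chart with ⟨e,e⟩ > 0 at `p` and f null at `p`; put E = ⟨e,e⟩, F =
⟨e,f⟩ and let l be the Gram determinant of e, f. In the orthonormal frame obtained from e, f by
Gram–Schmidt, γ' is proportional to (P, √l q), where P = ⟨e,γ'⟩ and q is the f-component of γ'. Up
to the sign of the normal, κ_g ds is the angular velocity of this planar vector plus the connection
form of the frame (`accelPairing_rotation`), and each summand has a limit at 0.

The connection form is (Γ(γ',e,f) − (F/E) Γ(γ',e,e)) / √l. By admissibility Γ(γ',e,f) vanishes at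
`p`, and so does F because f is null; both are O(t), which the factor t in √l compensates. For the
angular velocity (`exists_tendsto_angularVelocity`), if P(0) ≠ 0 the vector stays away from the
origin. If γ'(0) is a null vector, P and √l both vanish to first order, and dividing the vector by t
leaves its angle unchanged but makes its limit nonzero, since q(0) ≠ 0.

The given normal is ±1 times the normalized rotation of γ' (`eq_smul_rotation`), with a sign that is
constant near 0 by connectedness. The definition uses the preferred chart at each γ(t), so the
covariant acceleration is transported to one fixed chart (`accelInner_eq`). -/

lemma eventually_pos_nhdsGT : ∀ᶠ t : ℝ in 𝓝[>] 0, 0 < t := eventually_mem_nhdsWithin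

lemma tendsto_id_nhdsGT_zero : Tendsto (fun t : ℝ ↦ t) (𝓝[>] 0) (𝓝 0) :=
  tendsto_nhdsWithin_of_tendsto_nhds tendsto_id

lemma tendsto_div_id_of_hasDerivAt {f f' : ℝ → ℝ} {b : ℝ}
    (hf : ∀ᶠ t in 𝓝[>] (0 : ℝ), HasDerivAt f (f' t) t)
    (h0 : Tendsto f (𝓝[>] 0) (𝓝 0)) (h1 : Tendsto f' (𝓝[>] 0) (𝓝 b)) :
    Tendsto (fun t ↦ f t / t) (𝓝[>] 0) (𝓝 b) :=
  HasDerivAt.lhopital_zero_nhdsGT hf (Eventually.of_forall fun t ↦ hasDerivAt_id' t) (by simp) h0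
    tendsto_id_nhdsGT_zero (by simpa using h1)

/-- The hypothesis concerns f'/t rather than a second derivative, so that applications of
L'Hôpital's rule can be chained; the cubic case below follows the same pattern. -/
lemma tendsto_div_sq_of_hasDerivAt {f f' : ℝ → ℝ} {b : ℝ}
    (hf : ∀ᶠ t in 𝓝[>] (0 : ℝ), HasDerivAt f (f' t) t)
    (h0 : Tendsto f (𝓝[>] 0) (𝓝 0)) (h1 : Tendsto (fun t ↦ f' t / t) (𝓝[>] 0) (𝓝 b)) :
    Tendsto (fun t ↦ f t / t ^ 2) (𝓝[>] 0) (𝓝 (b / 2)) := by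
  refine HasDerivAt.lhopital_zero_nhdsGT hf
    (Eventually.of_forall fun t ↦ by simpa using hasDerivAt_pow 2 t) ?_ h0
    (by simpa using tendsto_id_nhdsGT_zero.pow 2) ((h1.div_const 2).congr' ?_)
  · filter_upwards [eventually_pos_nhdsGT] with t ht
    positivity
  · filter_upwards [eventually_pos_nhdsGT] with t ht
    field_simp

lemma tendsto_div_cube_of_hasDerivAt {f f' : ℝ → ℝ} {b : ℝ}
    (hf : ∀ᶠ t in 𝓝[>] (0 : ℝ), HasDerivAt f (f' t) t)
    (h0 : Tendsto f (𝓝[>] 0) (𝓝 0)) (h1 : Tendsto (fun t ↦ f' t / t ^ 2) (𝓝[>] 0) (𝓝 b)) :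
    Tendsto (fun t ↦ f t / t ^ 3) (𝓝[>] 0) (𝓝 (b / 3)) := by
  refine HasDerivAt.lhopital_zero_nhdsGT hf
    (Eventually.of_forall fun t ↦ by simpa using hasDerivAt_pow 3 t) ?_ h0
    (by simpa using tendsto_id_nhdsGT_zero.pow 3) ((h1.div_const 3).congr' ?_)
  · filter_upwards [eventually_pos_nhdsGT] with t ht
    positivity
  · filter_upwards [eventually_pos_nhdsGT] with t ht
    field_simp

/-- The derivative of `P / t` has a limit at `0` if `P` vanishes there. -/
lemma tendsto_deriv_div_id {P P' P'' : ℝ → ℝ} {p₁ p₂ : ℝ}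
    (hP : ∀ᶠ t in 𝓝[>] (0 : ℝ), HasDerivAt P (P' t) t)
    (hP' : ∀ᶠ t in 𝓝[>] (0 : ℝ), HasDerivAt P' (P'' t) t)
    (h0 : Tendsto P (𝓝[>] 0) (𝓝 0)) (h1 : Tendsto P' (𝓝[>] 0) (𝓝 p₁))
    (h2 : Tendsto P'' (𝓝[>] 0) (𝓝 p₂)) :
    Tendsto (fun t ↦ (t * P' t - P t) / t ^ 2) (𝓝[>] 0) (𝓝 (p₂ / 2)) := by
  refine tendsto_div_sq_of_hasDerivAt (f' := fun t ↦ t * P'' t) ?_ ?_ (h2.congr' ?_)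
  · filter_upwards [hP, hP'] with t a b
    exact (((hasDerivAt_id' t).mul b).sub a).congr_deriv (by ring)
  · simpa using (tendsto_id_nhdsGT_zero.mul h1).sub h0
  · filter_upwards [eventually_pos_nhdsGT] with t ht
    field_simp

/-- The derivative of `l / t ^ 2` has a limit at `0` if `l` vanishes there to second order. -/
lemma tendsto_deriv_div_sq {l l' l'' l''' : ℝ → ℝ} {h c : ℝ}
    (hl : ∀ᶠ t in 𝓝[>] (0 : ℝ), HasDerivAt l (l' t) t)
    (hl' : ∀ᶠ t in 𝓝[>] (0 : ℝ), HasDerivAt l' (l'' t) t)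
    (hl'' : ∀ᶠ t in 𝓝[>] (0 : ℝ), HasDerivAt l'' (l''' t) t)
    (h0 : Tendsto l (𝓝[>] 0) (𝓝 0)) (h1 : Tendsto l' (𝓝[>] 0) (𝓝 0))
    (h2 : Tendsto l'' (𝓝[>] 0) (𝓝 h)) (h3 : Tendsto l''' (𝓝[>] 0) (𝓝 c)) :
    Tendsto (fun t ↦ (t * l' t - 2 * l t) / t ^ 3) (𝓝[>] 0) (𝓝 (c / 2 / 3)) := by
  refine tendsto_div_cube_of_hasDerivAt (f' := fun t ↦ t * l'' t - l' t) ?_ ?_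
    (tendsto_deriv_div_id hl' hl'' h1 h2 h3)
  · filter_upwards [hl, hl'] with t a b
    exact (((hasDerivAt_id' t).mul b).sub (a.const_mul 2)).congr_deriv (by ring)
  · simpa using (tendsto_id_nhdsGT_zero.mul h1).sub (h0.const_mul 2)

/-- The angular velocity of the planar vector `(P, √l v)` has a limit at `0`, if `l` vanishes
there exactly to second order and `(P, v)` does not vanish at `0`. -/
lemma exists_tendsto_angularVelocity {P P' P'' v v' l l' l'' l''' : ℝ → ℝ}
    {p₀ p₁ p₂ v₀ v₁ h c : ℝ}
    (hP : ∀ᶠ t in 𝓝[>] (0 : ℝ), HasDerivAt P (P' t) t)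
    (hP' : ∀ᶠ t in 𝓝[>] (0 : ℝ), HasDerivAt P' (P'' t) t)
    (hl : ∀ᶠ t in 𝓝[>] (0 : ℝ), HasDerivAt l (l' t) t)
    (hl' : ∀ᶠ t in 𝓝[>] (0 : ℝ), HasDerivAt l' (l'' t) t)
    (hl'' : ∀ᶠ t in 𝓝[>] (0 : ℝ), HasDerivAt l'' (l''' t) t)
    (tP : Tendsto P (𝓝[>] 0) (𝓝 p₀)) (tP' : Tendsto P' (𝓝[>] 0) (𝓝 p₁))
    (tP'' : Tendsto P'' (𝓝[>] 0) (𝓝 p₂))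
    (tv : Tendsto v (𝓝[>] 0) (𝓝 v₀)) (tv' : Tendsto v' (𝓝[>] 0) (𝓝 v₁))
    (tl : Tendsto l (𝓝[>] 0) (𝓝 0)) (tl' : Tendsto l' (𝓝[>] 0) (𝓝 0))
    (tl'' : Tendsto l'' (𝓝[>] 0) (𝓝 h)) (tl''' : Tendsto l''' (𝓝[>] 0) (𝓝 c))
    (hh : 0 < h) (hne : p₀ = 0 → v₀ ≠ 0) :
    ∃ L, Tendsto (fun t ↦ (P t * (l' t * v t / (2 * √(l t)) + √(l t) * v' t)
      - √(l t) * v t * P' t) / (P t ^ 2 + l t * v t ^ 2)) (𝓝[>] 0) (𝓝 L) := by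
  have tl1 : Tendsto (fun t ↦ l' t / t) (𝓝[>] 0) (𝓝 h) := tendsto_div_id_of_hasDerivAt hl' tl' tl''
  have tl2 : Tendsto (fun t ↦ l t / t ^ 2) (𝓝[>] 0) (𝓝 (h / 2)) :=
    tendsto_div_sq_of_hasDerivAt hl tl tl1
  have hr0 : 0 < √(h / 2) := Real.sqrt_pos.2 (by positivity)
  have tr : Tendsto (fun t ↦ √(l t / t ^ 2)) (𝓝[>] 0) (𝓝 √(h / 2)) :=
    (Real.continuous_sqrt.tendsto _).comp tl2
  have hlpos : ∀ᶠ t in 𝓝[>] (0 : ℝ), 0 < l t / t ^ 2 := tl2.eventually_const_lt (by positivity)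
  -- Writes √l = t r with r = √(l / t²), which tends to √(h / 2) > 0; the singular square root is
  -- then only the explicit factor t.
  have key : ∀ᶠ t in 𝓝[>] (0 : ℝ), 0 < t ∧ 0 < √(l t / t ^ 2) ∧
      l t = (t * √(l t / t ^ 2)) ^ 2 ∧ √(l t) = t * √(l t / t ^ 2) := by
    filter_upwards [eventually_pos_nhdsGT, hlpos] with t ht hlt
    have h1 : l t = (t * √(l t / t ^ 2)) ^ 2 := by
      rw [mul_pow, Real.sq_sqrt hlt.le]; field_simp
    have h2 := Real.sqrt_pos.2 hlt
    refine ⟨ht, h2, h1, ?_⟩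
    conv_lhs => rw [h1]
    exact Real.sqrt_sq (by positivity)
  -- Null initial direction: the vector is replaced by (P / t, r v), of the same angle. The limits
  -- `tPd` and `tLd` are those of the derivatives of P / t and r², and the squared length tends to
  -- p₁² + (h / 2) v₀² > 0.
  by_cases hp : p₀ = 0
  · subst hp
    have hv := hne rfl
    have tp := tendsto_div_id_of_hasDerivAt hP tP tP'
    have tPd := tendsto_deriv_div_id hP hP' tP tP' tP''
    have tLd := tendsto_deriv_div_sq hl hl' hl'' tl tl' tl'' tl'''
    have T1 := (((tp.mul tLd).mul tv).div (tr.const_mul 2) (by positivity)).add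
      ((tp.mul tr).mul tv') |>.sub ((tr.mul tv).mul tPd)
    have T2 := (tp.pow 2).add ((tr.pow 2).mul (tv.pow 2))
    have hpos : p₁ ^ 2 + √(h / 2) ^ 2 * v₀ ^ 2 ≠ 0 := by positivity
    refine ⟨_, (T1.div T2 hpos).congr' ?_⟩
    filter_upwards [key] with t ⟨ht, hr, h1, h2⟩
    simp only [Pi.div_apply]
    rw [h2]
    generalize √(l t / t ^ 2) = r at *
    rw [h1]
    have e : P t ^ 2 + (t * r) ^ 2 * v t ^ 2 = t ^ 2 * ((P t / t) ^ 2 + r ^ 2 * v t ^ 2) := by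
      field_simp
    rw [e, ← div_div _ (t ^ 2) _]
    congr 1
    field_simp
    ring
  -- Transversal direction: the squared length tends to p₀² > 0, and l' / (2√l) = (l' / t) / (2r)
  -- has a finite limit.
  · have T1 := (tP.mul (((tl1.mul tv).div (tr.const_mul 2) (by positivity)).add
      ((tendsto_id_nhdsGT_zero.mul tr).mul tv'))).sub
        (((tendsto_id_nhdsGT_zero.mul tr).mul tv).mul tP')
    have T2 := (tP.pow 2).add (tl.mul (tv.pow 2))
    have hpos : p₀ ^ 2 + 0 * v₀ ^ 2 ≠ 0 := by simpa using hp
    refine ⟨_, (T1.div T2 hpos).congr' ?_⟩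
    filter_upwards [key] with t ⟨ht, hr, h1, h2⟩
    simp only [Pi.div_apply]
    rw [h2]
    congr 3
    field_simp

/-- On the side of a smooth curve, the iterated one-sided derivatives are honest derivatives. -/
lemma ContDiffOn.eventually_hasDerivAt_derivWithin {F : Type*} [NormedAddCommGroup F]
    [NormedSpace ℝ F] {f : ℝ → F} {δ : ℝ} (hδ : 0 < δ)
    (hf : ContDiffOn ℝ ∞ f (Ico 0 δ)) :
    ∀ᶠ t in 𝓝[>] (0 : ℝ), HasDerivAt f (derivWithin f (Ico 0 δ) t) t := by
  filter_upwards [Ioo_mem_nhdsGT hδ] with t ht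
  exact ((hf.differentiableOn (by simp)) t (Ioo_subset_Ico_self ht)).hasDerivWithinAt.hasDerivAt
    (Ico_mem_nhds ht.1 ht.2)

lemma ContDiffOn.derivWithin_Ico {F : Type*} [NormedAddCommGroup F]
    [NormedSpace ℝ F] {f : ℝ → F} {δ : ℝ} (hf : ContDiffOn ℝ ∞ f (Ico 0 δ)) :
    ContDiffOn ℝ ∞ (derivWithin f (Ico 0 δ)) (Ico 0 δ) :=
  hf.derivWithin (uniqueDiffOn_Ico 0 δ) (by simp)

lemma ContDiffOn.tendsto_nhdsGT {F : Type*} [NormedAddCommGroup F]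
    [NormedSpace ℝ F] {f : ℝ → F} {δ : ℝ} (hδ : 0 < δ) (hf : ContDiffOn ℝ ∞ f (Ico 0 δ)) :
    Tendsto f (𝓝[>] 0) (𝓝 (f 0)) := by
  have := hf.continuousOn 0 ⟨le_rfl, hδ⟩
  refine this.tendsto.mono_left (nhdsWithin_le_of_mem ?_)
  filter_upwards [Ioo_mem_nhdsGT hδ] with t ht using Ioo_subset_Ico_self ht

/-! ### The metric in a chart -/

namespace PosSemidefMetric

section

variable {M : Type*} [TopologicalSpace M] [ChartedSpace Plane M]

/-- The differential of the chart `φ` at `q`, with the tangent space identified with its model. -/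
def chartDeriv (φ : OpenPartialHomeomorph M Plane) (q : M) : Plane →L[ℝ] Plane :=
  mfderiv (𝓡 2) 𝓘(ℝ, Plane) φ q

/-- The differential of the inverse of the chart `φ` at `x`, with the tangent space identified
with its model. -/
def chartSymmDeriv (φ : OpenPartialHomeomorph M Plane) (x : Plane) : Plane →L[ℝ] Plane :=
  mfderiv 𝓘(ℝ, Plane) (𝓡 2) φ.symm x

variable {φ : OpenPartialHomeomorph M Plane}

lemma mdifferentiable_of_mem_maximalAtlas (hφ : φ ∈ IsManifold.maximalAtlas (𝓡 2) ∞ M) :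
    φ.MDifferentiable (𝓡 2) (𝓡 2) :=
  ⟨(contMDiffOn_of_mem_maximalAtlas hφ).mdifferentiableOn (by simp),
    (contMDiffOn_symm_of_mem_maximalAtlas hφ).mdifferentiableOn (by simp)⟩

lemma chartSymmDeriv_chartDeriv (hφ : φ ∈ IsManifold.maximalAtlas (𝓡 2) ∞ M) {q : M}
    (hq : q ∈ φ.source) (v : Plane) : chartSymmDeriv φ (φ q) (chartDeriv φ q v) = v :=
  congrArg (fun L : Plane →L[ℝ] Plane ↦ L v)
    ((mdifferentiable_of_mem_maximalAtlas hφ).symm_comp_deriv hq)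

lemma chartDeriv_chartSymmDeriv (hφ : φ ∈ IsManifold.maximalAtlas (𝓡 2) ∞ M) {q : M}
    (hq : q ∈ φ.source) (v : Plane) : chartDeriv φ q (chartSymmDeriv φ (φ q) v) = v := by
  have : chartDeriv φ (φ.symm (φ q)) (chartSymmDeriv φ (φ q) v) = v :=
    congrArg (fun L : Plane →L[ℝ] Plane ↦ L v)
      ((mdifferentiable_of_mem_maximalAtlas hφ).comp_symm_deriv (φ.map_source hq))
  rwa [φ.left_inv hq] at this

end

variable {M : Type*} [TopologicalSpace M] [ChartedSpace Plane M] [IsManifold (𝓡 2) ∞ M]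

/-- The bilinear form at `q`, with the tangent space identified with its model. -/
def planeForm (g : PosSemidefMetric M) (q : M) : Plane →L[ℝ] Plane →L[ℝ] ℝ := g.form q

/-- The metric in the coordinates of the chart `φ`, as a field of bilinear forms on the plane. -/
def chartForm (g : PosSemidefMetric M) (φ : OpenPartialHomeomorph M Plane) (x : Plane) :
    Plane →L[ℝ] Plane →L[ℝ] ℝ :=
  (g.planeForm (φ.symm x)).bilinearComp (chartSymmDeriv φ x) (chartSymmDeriv φ x)

variable (g : PosSemidefMetric M) {φ φ' : OpenPartialHomeomorph M Plane}

lemma chartForm_apply (x v w : Plane) :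
    g.chartForm φ x v w =
      g.planeForm (φ.symm x) (chartSymmDeriv φ x v) (chartSymmDeriv φ x w) := rfl

lemma coeff_eq_chartForm (x : Plane) (i j : Fin 2) :
    g.coeff φ x i j = g.chartForm φ x (EuclideanSpace.single i 1) (EuclideanSpace.single j 1) :=
  rfl

lemma chartForm_chartDeriv (hφ : φ ∈ IsManifold.maximalAtlas (𝓡 2) ∞ M) {q : M}
    (hq : q ∈ φ.source) (v w : Plane) :
    g.chartForm φ (φ q) (chartDeriv φ q v) (chartDeriv φ q w) = g.planeForm q v w := by
  rw [chartForm_apply, chartSymmDeriv_chartDeriv hφ hq, chartSymmDeriv_chartDeriv hφ hq,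
    φ.left_inv hq]

lemma chartForm_symm (x v w : Plane) : g.chartForm φ x v w = g.chartForm φ x w v :=
  g.symm _ _ _

lemma chartForm_nonneg (x v : Plane) : 0 ≤ g.chartForm φ x v v := g.nonneg _ _

/-- In finite dimension it suffices to evaluate on fixed vectors. A constant vector, pushed forward
by the inverse chart, is a smooth section because the tangent map of that chart is smooth. -/
lemma contDiffOn_chartForm (hφ : φ ∈ IsManifold.maximalAtlas (𝓡 2) ∞ M) :
    ContDiffOn ℝ ∞ (g.chartForm φ) φ.target := by
  rw [contDiffOn_clm_apply]
  intro v
  rw [contDiffOn_clm_apply]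
  intro w
  rw [← contMDiffOn_iff_contDiffOn]
  intro x hx
  have hs := contMDiffOn_symm_of_mem_maximalAtlas hφ
  have hvec : ∀ v : Plane, ContMDiffWithinAt 𝓘(ℝ, Plane) ((𝓡 2).prod 𝓘(ℝ, Plane)) ∞
      (fun y : Plane ↦ (TotalSpace.mk' Plane (φ.symm y)
        (chartSymmDeriv φ y v) : TangentBundle (𝓡 2) M)) φ.target x := by
    intro v
    have h1 := hs.contMDiffOn_tangentMapWithin (m := ∞) (by simp)
      φ.open_target.uniqueMDiffOn
    have h2 : ContMDiffOn 𝓘(ℝ, Plane) ((𝓡 2).prod 𝓘(ℝ, Plane)) ∞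
        (fun y : Plane ↦ (⟨y, v⟩ : TangentBundle 𝓘(ℝ, Plane) Plane)) φ.target := by
      intro y hy
      rw [contMDiffWithinAt_totalSpace]
      refine ⟨contMDiffWithinAt_id, ?_⟩
      simpa using contMDiffWithinAt_const
    have h3 := (h1.comp h2 (fun y hy ↦ hy)) x hx
    have h4 : ∀ y ∈ φ.target, (TotalSpace.mk' Plane (φ.symm y)
        (chartSymmDeriv φ y v) : TangentBundle (𝓡 2) M) =
        tangentMapWithin (𝓡 2) (𝓡 2) φ.symm φ.target ⟨y, v⟩ := fun y hy ↦ by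
      simp only [tangentMapWithin]
      rw [mfderivWithin_of_isOpen φ.open_target hy]
      rfl
    exact h3.congr h4 (h4 x hx)
  have : ContMDiffWithinAt 𝓘(ℝ, Plane) ((𝓡 2).prod 𝓘(ℝ, ℝ)) ∞
      (fun y ↦ TotalSpace.mk' ℝ (E := Bundle.Trivial M ℝ) (φ.symm y)
        (g.form (φ.symm y) (chartSymmDeriv φ y v) (chartSymmDeriv φ y w))) φ.target x := by
    apply ContMDiffWithinAt.clm_bundle_apply₂ (F₁ := Plane) (F₂ := Plane)
    · exact ContMDiffAt.comp_contMDiffWithinAt x g.contMDiff.contMDiffAt (hs x hx)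
    · exact hvec v
    · exact hvec w
  simp only [contMDiffWithinAt_totalSpace] at this
  exact this.2

lemma isSingular_iff (hφ : φ ∈ IsManifold.maximalAtlas (𝓡 2) ∞ M) {q : M} (hq : q ∈ φ.source) :
    g.IsSingular q ↔ ∃ v : Plane, v ≠ 0 ∧ ∀ w, g.chartForm φ (φ q) v w = 0 := by
  have key : g.IsSingular q ↔ ∃ v : Plane, (∀ w : Plane, g.planeForm q v w = 0) ∧ v ≠ 0 := Iff.rfl
  rw [key]
  constructor
  · rintro ⟨v, hv, hv0⟩
    refine ⟨chartDeriv φ q v, fun h ↦ hv0 ?_, fun w ↦ ?_⟩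
    · rw [← chartSymmDeriv_chartDeriv hφ hq v, h, map_zero]
    · rw [← chartDeriv_chartSymmDeriv hφ hq w, g.chartForm_chartDeriv hφ hq, hv]
  · rintro ⟨v, hv0, hv⟩
    refine ⟨chartSymmDeriv φ (φ q) v, fun w ↦ ?_, fun h ↦ hv0 ?_⟩
    · rw [← g.chartForm_chartDeriv hφ hq, chartDeriv_chartSymmDeriv hφ hq, hv]
    · rw [← chartDeriv_chartSymmDeriv hφ hq v, h, map_zero]

end PosSemidefMetric

/-! ### Christoffel symbols of the first kind -/

section

variable {E : Type*} [NormedAddCommGroup E] [NormedSpace ℝ E]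

/-- The Christoffel symbol of the first kind of a field of bilinear forms on a normed space. -/
def christoffelFirst (G : E → E →L[ℝ] E →L[ℝ] ℝ) (x a b c : E) : ℝ :=
  (1 / 2) * (fderiv ℝ G x a b c + fderiv ℝ G x b a c - fderiv ℝ G x c a b)

/-- The covariant acceleration, paired with the vector `w`, of a curve with position `x`,
velocity `v` and second derivative `a`. -/
def accelPairing (G : E → E →L[ℝ] E →L[ℝ] ℝ) (x v a w : E) : ℝ :=
  G x a w + christoffelFirst G x v v w

lemma fderiv_clm_apply₂ {G : E → E →L[ℝ] E →L[ℝ] ℝ} {x : E}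
    (hG : DifferentiableAt ℝ G x) (a b c : E) :
    fderiv ℝ (fun y ↦ G y b c) x a = fderiv ℝ G x a b c := by
  have h : HasFDerivAt (fun y ↦ G y b c) _ x :=
    (hG.hasFDerivAt.clm_apply (hasFDerivAt_const b x)).clm_apply (hasFDerivAt_const c x)
  rw [h.fderiv]
  simp

lemma hasFDerivAt_fun_comp {F : Type*} [NormedAddCommGroup F] [NormedSpace ℝ F] {G : E → F}
    {ψ : E → E} {y : E} (hG : DifferentiableAt ℝ G (ψ y)) (hψ : DifferentiableAt ℝ ψ y) :
    HasFDerivAt (fun z ↦ G (ψ z)) ((fderiv ℝ G (ψ y)).comp (fderiv ℝ ψ y)) y :=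
  hG.hasFDerivAt.comp y hψ.hasFDerivAt

/-- The covariant acceleration does not depend on the coordinates. -/
lemma accelPairing_pullback {G G' : E → E →L[ℝ] E →L[ℝ] ℝ} {ψ : E → E}
    {y : E} (hψ : ContDiffAt ℝ ∞ ψ y) (hG : DifferentiableAt ℝ G (ψ y))
    (hG' : DifferentiableAt ℝ G' y)
    (hsymm : ∀ v w, G (ψ y) v w = G (ψ y) w v)
    (h : ∀ᶠ z in 𝓝 y, ∀ v w, G' z v w = G (ψ z) (fderiv ℝ ψ z v) (fderiv ℝ ψ z w))
    (v a w : E) :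
    accelPairing G' y v a w = accelPairing G (ψ y) (fderiv ℝ ψ y v)
      (fderiv ℝ ψ y a + fderiv ℝ (fderiv ℝ ψ) y v v) (fderiv ℝ ψ y w) := by
  have hD : DifferentiableAt ℝ (fderiv ℝ ψ) y :=
    (hψ.fderiv_right (m := 1) (by norm_cast)).differentiableAt (by simp)
  have hψd : DifferentiableAt ℝ ψ y := hψ.differentiableAt (by simp)
  have key : ∀ a b c, fderiv ℝ G' y a b c =
      fderiv ℝ G (ψ y) (fderiv ℝ ψ y a) (fderiv ℝ ψ y b) (fderiv ℝ ψ y c)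
      + G (ψ y) (fderiv ℝ (fderiv ℝ ψ) y a b) (fderiv ℝ ψ y c)
      + G (ψ y) (fderiv ℝ ψ y b) (fderiv ℝ (fderiv ℝ ψ) y a c) := by
    intro a b c
    rw [← fderiv_clm_apply₂ hG']
    have e : (fun z ↦ G' z b c) =ᶠ[𝓝 y]
        fun z ↦ G (ψ z) (fderiv ℝ ψ z b) (fderiv ℝ ψ z c) := by
      filter_upwards [h] with z hz using hz b c
    rw [e.fderiv_eq]
    have hGψ := hasFDerivAt_fun_comp (F := E →L[ℝ] E →L[ℝ] ℝ) hG hψd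
    have hb : HasFDerivAt (fun z ↦ fderiv ℝ ψ z b) _ y :=
      hD.hasFDerivAt.clm_apply (hasFDerivAt_const b y)
    have hc : HasFDerivAt (fun z ↦ fderiv ℝ ψ z c) _ y :=
      hD.hasFDerivAt.clm_apply (hasFDerivAt_const c y)
    have := (hGψ.clm_apply hb).clm_apply hc
    rw [this.fderiv]
    simp
    ring
  have hsnd : ∀ a b, fderiv ℝ (fderiv ℝ ψ) y a b = fderiv ℝ (fderiv ℝ ψ) y b a :=
    fun a b ↦ (hψ.isSymmSndFDerivAt (by simp; norm_cast)) a b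
  unfold accelPairing christoffelFirst
  simp only [key, h.self_of_nhds, map_add, add_apply]
  -- Of the terms with second derivatives of ψ, those pairing Dψ(v) with D²ψ(v, w) cancel by
  -- symmetry. Only the pairing of D²ψ(v, v) with Dψ(w) survives, which is the correction in the
  -- transformed acceleration.
  rw [hsnd w v, hsymm (fderiv ℝ ψ y v) (fderiv ℝ (fderiv ℝ ψ) y v w)]
  ring

end

/-! ### Constant fields of a chart and admissibility -/

namespace PosSemidefMetric

section

variable {M : Type*} [TopologicalSpace M] [ChartedSpace Plane M]
  {φ : OpenPartialHomeomorph M Plane}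

/-- The vector field with constant components `a` in the chart `φ`. -/
def constField (φ : OpenPartialHomeomorph M Plane) (a : Plane) : Π q : M, TangentSpace (𝓡 2) q :=
  VectorField.mpullback (𝓡 2) 𝓘(ℝ, Plane) φ (fun _ ↦ a)

lemma constField_eq (hφ : φ ∈ IsManifold.maximalAtlas (𝓡 2) ∞ M) {q : M} (hq : q ∈ φ.source)
    (a : Plane) : (constField φ a q : Plane) = chartSymmDeriv φ (φ q) a := by
  have : (chartDeriv φ q).inverse = chartSymmDeriv φ (φ q) :=
    ContinuousLinearMap.inverse_eq
      (ContinuousLinearMap.ext fun v ↦ chartDeriv_chartSymmDeriv hφ hq v)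
      (ContinuousLinearMap.ext fun v ↦ chartSymmDeriv_chartDeriv hφ hq v)
  exact congrArg (fun L : Plane →L[ℝ] Plane ↦ L a) this

lemma isInvertible_mfderiv (hφ : φ ∈ IsManifold.maximalAtlas (𝓡 2) ∞ M) {q : M}
    (hq : q ∈ φ.source) : (mfderiv (𝓡 2) 𝓘(ℝ, Plane) φ q).IsInvertible :=
  ContinuousLinearMap.IsInvertible.of_inverse (g := chartSymmDeriv φ (φ q))
    (ContinuousLinearMap.ext fun v ↦ chartDeriv_chartSymmDeriv hφ hq v)
    (ContinuousLinearMap.ext fun v ↦ chartSymmDeriv_chartDeriv hφ hq v)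

end

variable {M : Type*} [TopologicalSpace M] [ChartedSpace Plane M] [IsManifold (𝓡 2) ∞ M]
  (g : PosSemidefMetric M) {φ : OpenPartialHomeomorph M Plane}

lemma contMDiffAt_const_field (a : Plane) (x : Plane) :
    ContMDiffAt 𝓘(ℝ, Plane) ((𝓡 2).prod 𝓘(ℝ, Plane)) ∞
      (fun y : Plane ↦ (⟨y, a⟩ : TangentBundle 𝓘(ℝ, Plane) Plane)) x := by
  rw [contMDiffAt_totalSpace]
  refine ⟨contMDiffAt_id, ?_⟩
  simpa using contMDiffAt_const

lemma smoothFieldAt_constField (hφ : φ ∈ IsManifold.maximalAtlas (𝓡 2) ∞ M) {q : M}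
    (hq : q ∈ φ.source) (a : Plane) : SmoothFieldAt (constField φ a) q :=
  ContMDiffAt.mpullback_vectorField_preimage (n := ∞) (m := ∞)
    (V := (fun _ ↦ a : Π x : Plane, TangentSpace 𝓘(ℝ, Plane) x)) (contMDiffAt_const_field a (φ q))
    (contMDiffAt_of_mem_maximalAtlas hφ hq) (isInvertible_mfderiv hφ hq) (by simp)

/-- Pullback commutes with the Lie bracket, and constant fields on the plane commute. -/
lemma mlieBracket_constField (hφ : φ ∈ IsManifold.maximalAtlas (𝓡 2) ∞ M) {q : M}
    (hq : q ∈ φ.source) (a b : Plane) :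
    VectorField.mlieBracket (𝓡 2) (constField φ a) (constField φ b) q = 0 := by
  have : IsManifold (𝓡 2) (minSmoothness ℝ 2) M := IsManifold.of_le (n := ∞) (by simp; norm_cast)
  have h := VectorField.mpullback_mlieBracket (n := ∞) (I := 𝓡 2) (I' := 𝓘(ℝ, Plane)) (f := φ)
    (V := fun _ ↦ a) (W := fun _ ↦ b) (x₀ := q)
    ((contMDiffAt_const_field a (φ q)).mdifferentiableAt (by simp))
    ((contMDiffAt_const_field b (φ q)).mdifferentiableAt (by simp))
    (contMDiffAt_of_mem_maximalAtlas hφ hq) (by simp; norm_cast)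
  refine h.symm.trans ?_
  have h0 : VectorField.lieBracketWithin ℝ (fun _ : Plane ↦ a) (fun _ ↦ b) univ = 0 := by
    ext1 x
    simp [VectorField.lieBracket_eq]
  have h1 : VectorField.mlieBracket 𝓘(ℝ, Plane) (fun _ : Plane ↦ a) (fun _ ↦ b) = 0 :=
    (VectorField.mlieBracketWithin_univ.symm.trans
      VectorField.mlieBracketWithin_eq_lieBracketWithin).trans h0
  rw [h1, VectorField.mpullback_zero]
  rfl

lemma dirDeriv_constField (hφ : φ ∈ IsManifold.maximalAtlas (𝓡 2) ∞ M) {q : M}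
    (hq : q ∈ φ.source) (a b c : Plane) :
    g.dirDeriv (constField φ a) (constField φ b) (constField φ c) q =
      fderiv ℝ (g.chartForm φ) (φ q) a b c := by
  have hd : DifferentiableAt ℝ (g.chartForm φ) (φ q) :=
    ((g.contDiffOn_chartForm hφ).differentiableOn (by simp)).differentiableAt
      (φ.open_target.mem_nhds (φ.map_source hq))
  have hd' : DifferentiableAt ℝ (fun x ↦ g.chartForm φ x b c) (φ q) :=
    (hd.clm_apply (differentiableAt_const b)).clm_apply (differentiableAt_const c)
  have e : (fun x ↦ g.form x (constField φ b x) (constField φ c x)) =ᶠ[𝓝 q]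
      (fun x ↦ g.chartForm φ x b c) ∘ φ := by
    filter_upwards [φ.open_source.mem_nhds hq] with x hx
    change g.planeForm x (constField φ b x) (constField φ c x) = _
    rw [constField_eq hφ hx, constField_eq hφ hx, Function.comp, chartForm_apply, φ.left_inv hx]
  unfold dirDeriv
  rw [e.mfderiv_eq, mfderiv_comp q hd'.mdifferentiableAt
    ((contMDiffAt_of_mem_maximalAtlas hφ hq).mdifferentiableAt (by simp)), mfderiv_eq_fderiv]
  change fderiv ℝ (fun x ↦ g.chartForm φ x b c) (φ q) (chartDeriv φ q (constField φ a q)) = _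
  rw [constField_eq hφ hq, chartDeriv_chartSymmDeriv hφ hq, fderiv_clm_apply₂ hd]

lemma kossowski_constField (hφ : φ ∈ IsManifold.maximalAtlas (𝓡 2) ∞ M) {q : M}
    (hq : q ∈ φ.source) (a b c : Plane) :
    g.kossowski (constField φ a) (constField φ b) (constField φ c) q =
      (1 / 2) * (fderiv ℝ (g.chartForm φ) (φ q) a b c + fderiv ℝ (g.chartForm φ) (φ q) b c a
        - fderiv ℝ (g.chartForm φ) (φ q) c a b) := by
  unfold kossowski
  rw [mlieBracket_constField hφ hq, mlieBracket_constField hφ hq, mlieBracket_constField hφ hq,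
    g.dirDeriv_constField hφ hq, g.dirDeriv_constField hφ hq, g.dirDeriv_constField hφ hq]
  simp

lemma fderiv_chartForm_symm (hφ : φ ∈ IsManifold.maximalAtlas (𝓡 2) ∞ M) {x : Plane}
    (hx : x ∈ φ.target) (a b c : Plane) :
    fderiv ℝ (g.chartForm φ) x a b c = fderiv ℝ (g.chartForm φ) x a c b := by
  have hd : DifferentiableAt ℝ (g.chartForm φ) x :=
    ((g.contDiffOn_chartForm hφ).differentiableOn (by simp)).differentiableAt
      (φ.open_target.mem_nhds hx)
  rw [← fderiv_clm_apply₂ hd, ← fderiv_clm_apply₂ hd]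
  simp only [g.chartForm_symm _ b c]

/-- Admissibility is tested on the constant fields of the chart. Their brackets vanish, so the
pseudo-connection reduces to the Christoffel symbol of the first kind. -/
lemma christoffelFirst_chartForm_eq_zero (hg : g.Admissible)
    (hφ : φ ∈ IsManifold.maximalAtlas (𝓡 2) ∞ M) {q : M}
    (hq : q ∈ φ.source) {c : Plane} (hc0 : c ≠ 0) (hc : ∀ w, g.chartForm φ (φ q) c w = 0)
    (a b : Plane) : christoffelFirst (g.chartForm φ) (φ q) a b c = 0 := by
  have h := hg q ((g.isSingular_iff hφ hq).2 ⟨c, hc0, hc⟩) (constField φ a) (constField φ b)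
    (constField φ c) (smoothFieldAt_constField hφ hq a) (smoothFieldAt_constField hφ hq b)
    (smoothFieldAt_constField hφ hq c) fun (w : Plane) ↦ by
      change g.planeForm q (constField φ c q) w = 0
      rw [constField_eq hφ hq, ← g.chartForm_chartDeriv hφ hq, chartDeriv_chartSymmDeriv hφ hq, hc]
  rw [g.kossowski_constField hφ hq,
    g.fderiv_chartForm_symm hφ (φ.map_source hq) b c a] at h
  exact h

end PosSemidefMetric

/-! ### Curves in charts -/

lemma HasDerivWithinAt.clm_comp_apply {E F H : Type*} [NormedAddCommGroup E] [NormedSpace ℝ E]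
    [NormedAddCommGroup F] [NormedSpace ℝ F] [NormedAddCommGroup H] [NormedSpace ℝ H]
    {L : E → F →L[ℝ] H} {y : ℝ → E} {v : ℝ → F} {y' : E} {v' : F} {J : Set ℝ} {t : ℝ}
    (hy : HasDerivWithinAt y y' J t) (hL : DifferentiableAt ℝ L (y t))
    (hv : HasDerivWithinAt v v' J t) :
    HasDerivWithinAt (fun s ↦ L (y s) (v s)) (fderiv ℝ L (y t) y' (v t) + L (y t) v') J t :=
  (hL.hasFDerivAt.comp_hasDerivWithinAt t hy).clm_apply hv

lemma OpenPartialHomeomorph.eventually_transition {M X Y : Type*} [TopologicalSpace M]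
    [TopologicalSpace X] [TopologicalSpace Y] {φ : OpenPartialHomeomorph M X}
    {φ' : OpenPartialHomeomorph M Y} {q : M} (hq : q ∈ φ.source) (hq' : q ∈ φ'.source) :
    ∀ᶠ z in 𝓝 (φ' q), z ∈ φ'.target ∧ φ'.symm z ∈ φ.source := by
  have h1 := φ'.open_target.mem_nhds (φ'.map_source hq')
  have h2 := (φ'.continuousAt_symm (φ'.map_source hq')).eventually
    (φ.open_source.mem_nhds (by rwa [φ'.left_inv hq']))
  filter_upwards [h1, h2] with z a b using ⟨a, b⟩

namespace PosSemidefMetric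

section

variable {M : Type*} [TopologicalSpace M] [ChartedSpace Plane M]
  {φ φ' : OpenPartialHomeomorph M Plane} {γ : ℝ → M} {J : Set ℝ} {t : ℝ}

/-- The velocity, with the tangent space identified with its model. -/
def planeVelocity (γ : ℝ → M) (J : Set ℝ) (t : ℝ) : Plane := velocity γ J t

/-- The velocity, in the coordinates of the chart `φ`. -/
def chartVelocity (φ : OpenPartialHomeomorph M Plane) (γ : ℝ → M) (J : Set ℝ) : ℝ → Plane :=
  derivWithin (fun s ↦ φ (γ s)) J

/-- The second derivative, in the coordinates of the chart `φ`. -/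
def chartAccel (φ : OpenPartialHomeomorph M Plane) (γ : ℝ → M) (J : Set ℝ) : ℝ → Plane :=
  derivWithin (chartVelocity φ γ J) J

lemma contDiffWithinAt_chart_comp (hφ : φ ∈ IsManifold.maximalAtlas (𝓡 2) ∞ M)
    (hγ : ContMDiffWithinAt 𝓘(ℝ, ℝ) (𝓡 2) ∞ γ J t) (ht : γ t ∈ φ.source) :
    ContDiffWithinAt ℝ ∞ (fun s ↦ φ (γ s)) J t := by
  rw [← contMDiffWithinAt_iff_contDiffWithinAt]
  exact (contMDiffAt_of_mem_maximalAtlas hφ ht).comp_contMDiffWithinAt t hγ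

lemma contDiffWithinAt_chartVelocity (hφ : φ ∈ IsManifold.maximalAtlas (𝓡 2) ∞ M)
    (hJ : UniqueDiffOn ℝ J) (hγ : ContMDiffWithinAt 𝓘(ℝ, ℝ) (𝓡 2) ∞ γ J t)
    (htJ : t ∈ J) (ht : γ t ∈ φ.source) :
    ContDiffWithinAt ℝ ∞ (chartVelocity φ γ J) J t :=
  (contDiffWithinAt_chart_comp hφ hγ ht).derivWithin hJ (by simp) htJ

lemma contDiffWithinAt_chartAccel (hφ : φ ∈ IsManifold.maximalAtlas (𝓡 2) ∞ M)
    (hJ : UniqueDiffOn ℝ J) (hγ : ContMDiffWithinAt 𝓘(ℝ, ℝ) (𝓡 2) ∞ γ J t)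
    (htJ : t ∈ J) (ht : γ t ∈ φ.source) :
    ContDiffWithinAt ℝ ∞ (chartAccel φ γ J) J t :=
  (contDiffWithinAt_chartVelocity hφ hJ hγ htJ ht).derivWithin hJ (by simp) htJ

lemma eventually_mem_source (hγ : ContMDiffWithinAt 𝓘(ℝ, ℝ) (𝓡 2) ∞ γ J t)
    (ht : γ t ∈ φ.source) : ∀ᶠ s in 𝓝[J] t, γ s ∈ φ.source :=
  hγ.continuousWithinAt.eventually (φ.open_source.mem_nhds ht)

lemma chartVelocity_eq (hφ : φ ∈ IsManifold.maximalAtlas (𝓡 2) ∞ M)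
    (hJ : UniqueDiffOn ℝ J) (hγ : ContMDiffWithinAt 𝓘(ℝ, ℝ) (𝓡 2) ∞ γ J t)
    (htJ : t ∈ J) (ht : γ t ∈ φ.source) :
    chartVelocity φ γ J t = chartDeriv φ (γ t) (planeVelocity γ J t) := by
  have h := mfderiv_comp_mfderivWithin (I := 𝓘(ℝ, ℝ)) (I' := 𝓡 2) (I'' := 𝓘(ℝ, Plane)) t
    ((contMDiffAt_of_mem_maximalAtlas hφ ht).mdifferentiableAt (by simp))
    (hγ.mdifferentiableWithinAt (by simp)) (hJ t htJ).uniqueMDiffWithinAt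
  rw [mfderivWithin_eq_fderivWithin] at h
  exact congrArg (fun L : ℝ →L[ℝ] Plane ↦ L 1) h

lemma derivWithin_coord {x : ℝ → Plane} (hx : DifferentiableWithinAt ℝ x J t)
    (hJ : UniqueDiffWithinAt ℝ J t) (k : Fin 2) :
    derivWithin (fun s ↦ x s k) J t = derivWithin x J t k :=
  ((EuclideanSpace.proj (𝕜 := ℝ) k).hasFDerivAt.comp_hasDerivWithinAt t
    hx.hasDerivWithinAt).derivWithin hJ

lemma derivWithin_chart_coord (hφ : φ ∈ IsManifold.maximalAtlas (𝓡 2) ∞ M)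
    (hJ : UniqueDiffOn ℝ J) (hγ : ContMDiffWithinAt 𝓘(ℝ, ℝ) (𝓡 2) ∞ γ J t)
    (htJ : t ∈ J) (ht : γ t ∈ φ.source) (k : Fin 2) :
    derivWithin (fun s ↦ φ (γ s) k) J t = chartVelocity φ γ J t k :=
  derivWithin_coord ((contDiffWithinAt_chart_comp hφ hγ ht).differentiableWithinAt (by simp))
    (hJ t htJ) k

/-- The curve may leave the chart domain, so the first derivatives are identified only near t within
J, which is enough to differentiate once more. -/
lemma derivWithin_derivWithin_chart_coord (hφ : φ ∈ IsManifold.maximalAtlas (𝓡 2) ∞ M)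
    (hJ : UniqueDiffOn ℝ J) (hγ : ContMDiffOn 𝓘(ℝ, ℝ) (𝓡 2) ∞ γ J)
    (htJ : t ∈ J) (ht : γ t ∈ φ.source) (k : Fin 2) :
    derivWithin (derivWithin (fun s ↦ φ (γ s) k) J) J t = chartAccel φ γ J t k := by
  have e : derivWithin (fun s ↦ φ (γ s) k) J =ᶠ[𝓝[J] t] fun s ↦ chartVelocity φ γ J s k := by
    filter_upwards [eventually_mem_source (hγ t htJ) ht, self_mem_nhdsWithin] with s hs hsJ
    exact derivWithin_chart_coord hφ hJ (hγ s hsJ) hsJ hs k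
  rw [e.derivWithin_eq (derivWithin_chart_coord hφ hJ (hγ t htJ) htJ ht k)]
  exact derivWithin_coord
    ((contDiffWithinAt_chartVelocity hφ hJ (hγ t htJ) htJ ht).differentiableWithinAt (by simp))
    (hJ t htJ) k

lemma contDiffAt_transition (hφ : φ ∈ IsManifold.maximalAtlas (𝓡 2) ∞ M)
    (hφ' : φ' ∈ IsManifold.maximalAtlas (𝓡 2) ∞ M) {z : Plane} (hz : z ∈ φ'.target)
    (hz' : φ'.symm z ∈ φ.source) : ContDiffAt ℝ ∞ (fun y ↦ φ (φ'.symm y)) z := by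
  rw [← contMDiffAt_iff_contDiffAt]
  exact (contMDiffAt_of_mem_maximalAtlas hφ hz').comp z
    (contMDiffAt_symm_of_mem_maximalAtlas hφ' hz)

lemma fderiv_transition (hφ : φ ∈ IsManifold.maximalAtlas (𝓡 2) ∞ M)
    (hφ' : φ' ∈ IsManifold.maximalAtlas (𝓡 2) ∞ M) {z : Plane} (hz : z ∈ φ'.target)
    (hz' : φ'.symm z ∈ φ.source) (v : Plane) :
    fderiv ℝ (fun y ↦ φ (φ'.symm y)) z v =
      chartDeriv φ (φ'.symm z) (chartSymmDeriv φ' z v) := by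
  have h := mfderiv_comp (I := 𝓘(ℝ, Plane)) (I' := 𝓡 2) (I'' := 𝓘(ℝ, Plane)) z
    ((contMDiffAt_of_mem_maximalAtlas hφ hz').mdifferentiableAt (by simp))
    ((contMDiffAt_symm_of_mem_maximalAtlas hφ' hz).mdifferentiableAt (by simp))
  rw [mfderiv_eq_fderiv] at h
  exact congrArg (fun L : Plane →L[ℝ] Plane ↦ L v) h

lemma fderiv_transition_chartVelocity (hφ : φ ∈ IsManifold.maximalAtlas (𝓡 2) ∞ M)
    (hφ' : φ' ∈ IsManifold.maximalAtlas (𝓡 2) ∞ M)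
    (hJ : UniqueDiffOn ℝ J) (hγ : ContMDiffWithinAt 𝓘(ℝ, ℝ) (𝓡 2) ∞ γ J t)
    (htJ : t ∈ J) (ht : γ t ∈ φ.source) (ht' : γ t ∈ φ'.source) :
    chartVelocity φ γ J t =
      fderiv ℝ (fun y ↦ φ (φ'.symm y)) (φ' (γ t)) (chartVelocity φ' γ J t) := by
  rw [fderiv_transition hφ hφ' (φ'.map_source ht') (by rwa [φ'.left_inv ht']),
    chartVelocity_eq hφ' hJ hγ htJ ht', chartVelocity_eq hφ hJ hγ htJ ht,
    chartSymmDeriv_chartDeriv hφ' ht', φ'.left_inv ht']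

/-- Differentiating the transformation rule of the velocity once more along γ produces the second
derivative of the transition map; this is the term that `accelPairing_pullback` absorbs. -/
lemma chartAccel_transition (hφ : φ ∈ IsManifold.maximalAtlas (𝓡 2) ∞ M)
    (hφ' : φ' ∈ IsManifold.maximalAtlas (𝓡 2) ∞ M)
    (hJ : UniqueDiffOn ℝ J) (hγ : ContMDiffOn 𝓘(ℝ, ℝ) (𝓡 2) ∞ γ J)
    (htJ : t ∈ J) (ht : γ t ∈ φ.source) (ht' : γ t ∈ φ'.source) :
    chartAccel φ γ J t =
      fderiv ℝ (fun y ↦ φ (φ'.symm y)) (φ' (γ t)) (chartAccel φ' γ J t) +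
      fderiv ℝ (fderiv ℝ (fun y ↦ φ (φ'.symm y))) (φ' (γ t))
        (chartVelocity φ' γ J t) (chartVelocity φ' γ J t) := by
  have hψ : ContDiffAt ℝ ∞ (fun y ↦ φ (φ'.symm y)) (φ' (γ t)) :=
    contDiffAt_transition hφ hφ' (φ'.map_source ht') (by rwa [φ'.left_inv ht'])
  generalize hψe : (fun y ↦ φ (φ'.symm y)) = ψ at hψ ⊢
  have e : chartVelocity φ γ J =ᶠ[𝓝[J] t]
      fun s ↦ fderiv ℝ ψ (φ' (γ s)) (chartVelocity φ' γ J s) := by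
    filter_upwards [eventually_mem_source (hγ t htJ) ht, eventually_mem_source (hγ t htJ) ht',
      self_mem_nhdsWithin] with s hs hs' hsJ
    rw [← hψe]
    exact fderiv_transition_chartVelocity hφ hφ' hJ (hγ s hsJ) hsJ hs hs'
  have hD : DifferentiableAt ℝ (fderiv ℝ ψ) (φ' (γ t)) :=
    (hψ.fderiv_right (m := 1) (by norm_cast)).differentiableAt (by simp)
  have h1 : HasDerivWithinAt (fun s ↦ φ' (γ s)) (chartVelocity φ' γ J t) J t :=
    ((contDiffWithinAt_chart_comp hφ' (hγ t htJ) ht').differentiableWithinAt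
      (by simp)).hasDerivWithinAt
  have h2 : HasDerivWithinAt (chartVelocity φ' γ J) (chartAccel φ' γ J t) J t :=
    ((contDiffWithinAt_chartVelocity hφ' hJ (hγ t htJ) htJ ht').differentiableWithinAt
      (by simp)).hasDerivWithinAt
  have h3 := h1.clm_comp_apply hD h2
  unfold chartAccel
  rw [e.derivWithin_eq (e.self_of_nhdsWithin htJ)]
  rw [add_comm]
  exact h3.derivWithin (hJ t htJ)

end

variable {M : Type*} [TopologicalSpace M] [ChartedSpace Plane M] [IsManifold (𝓡 2) ∞ M]
  (g : PosSemidefMetric M) {φ φ' : OpenPartialHomeomorph M Plane} {γ : ℝ → M} {J : Set ℝ} {t : ℝ}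

lemma chartForm_transition (hφ : φ ∈ IsManifold.maximalAtlas (𝓡 2) ∞ M)
    (hφ' : φ' ∈ IsManifold.maximalAtlas (𝓡 2) ∞ M) {z : Plane} (hz : z ∈ φ'.target)
    (hz' : φ'.symm z ∈ φ.source) (v w : Plane) :
    g.chartForm φ' z v w = g.chartForm φ (φ (φ'.symm z))
      (fderiv ℝ (fun y ↦ φ (φ'.symm y)) z v) (fderiv ℝ (fun y ↦ φ (φ'.symm y)) z w) := by
  rw [fderiv_transition hφ hφ' hz hz', fderiv_transition hφ hφ' hz hz',
    g.chartForm_chartDeriv hφ hz', chartForm_apply]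

lemma differentiableAt_chartForm (hφ : φ ∈ IsManifold.maximalAtlas (𝓡 2) ∞ M) {x : Plane}
    (hx : x ∈ φ.target) : DifferentiableAt ℝ (g.chartForm φ) x :=
  ((g.contDiffOn_chartForm hφ).differentiableOn (by simp)).differentiableAt
    (φ.open_target.mem_nhds hx)

lemma accelPairing_transition (hφ : φ ∈ IsManifold.maximalAtlas (𝓡 2) ∞ M)
    (hφ' : φ' ∈ IsManifold.maximalAtlas (𝓡 2) ∞ M)
    (hJ : UniqueDiffOn ℝ J) (hγ : ContMDiffOn 𝓘(ℝ, ℝ) (𝓡 2) ∞ γ J)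
    (htJ : t ∈ J) (ht : γ t ∈ φ.source) (ht' : γ t ∈ φ'.source) (n : Plane) :
    accelPairing (g.chartForm φ') (φ' (γ t)) (chartVelocity φ' γ J t) (chartAccel φ' γ J t)
      (chartDeriv φ' (γ t) n) =
    accelPairing (g.chartForm φ) (φ (γ t)) (chartVelocity φ γ J t) (chartAccel φ γ J t)
      (chartDeriv φ (γ t) n) := by
  have hz := φ'.map_source ht'
  have hz' : φ'.symm (φ' (γ t)) ∈ φ.source := by rwa [φ'.left_inv ht']
  have hn : fderiv ℝ (fun y ↦ φ (φ'.symm y)) (φ' (γ t)) (chartDeriv φ' (γ t) n) =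
      chartDeriv φ (γ t) n := by
    rw [fderiv_transition hφ hφ' hz hz', chartSymmDeriv_chartDeriv hφ' ht', φ'.left_inv ht']
  have h := accelPairing_pullback (G := g.chartForm φ) (G' := g.chartForm φ')
    (contDiffAt_transition hφ hφ' hz hz')
    (g.differentiableAt_chartForm hφ (φ.map_source hz')) (g.differentiableAt_chartForm hφ' hz)
    (g.chartForm_symm _)
    ((OpenPartialHomeomorph.eventually_transition ht ht').mono fun z hz v w ↦ g.chartForm_transition hφ hφ' hz.1 hz.2 v w)
    (chartVelocity φ' γ J t) (chartAccel φ' γ J t) (chartDeriv φ' (γ t) n)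
  rw [h, hn, ← chartAccel_transition hφ hφ' hJ hγ htJ ht ht',
    ← fderiv_transition_chartVelocity hφ hφ' hJ (hγ t htJ) htJ ht ht', φ'.left_inv ht']

end PosSemidefMetric

/-! ### Bilinear forms on the plane -/

lemma Plane.eq_sum_single (v : Plane) :
    v = v 0 • EuclideanSpace.single 0 (1 : ℝ) + v 1 • EuclideanSpace.single 1 (1 : ℝ) := by
  ext i
  fin_cases i <;> simp

lemma Plane.bilin_expand (B : Plane →L[ℝ] Plane →L[ℝ] ℝ) (v w : Plane) :
    B v w = v 0 * w 0 * B (EuclideanSpace.single 0 1) (EuclideanSpace.single 0 1)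
      + v 0 * w 1 * B (EuclideanSpace.single 0 1) (EuclideanSpace.single 1 1)
      + v 1 * w 0 * B (EuclideanSpace.single 1 1) (EuclideanSpace.single 0 1)
      + v 1 * w 1 * B (EuclideanSpace.single 1 1) (EuclideanSpace.single 1 1) := by
  conv_lhs => rw [Plane.eq_sum_single v, Plane.eq_sum_single w]
  simp only [map_add, map_smul, add_apply, smul_apply, smul_eq_mul]
  ring

lemma Plane.clm_expand {F H : Type*} [NormedAddCommGroup F] [NormedSpace ℝ F]
    [NormedAddCommGroup H] [NormedSpace ℝ H] (T : Plane →L[ℝ] F →L[ℝ] H) (u : Plane) (v : F) :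
    T u v = u 0 • T (EuclideanSpace.single 0 1) v + u 1 • T (EuclideanSpace.single 1 1) v := by
  conv_lhs => rw [Plane.eq_sum_single u]
  simp

lemma Plane.trilin_expand (T : Plane →L[ℝ] Plane →L[ℝ] Plane →L[ℝ] ℝ) (u v w : Plane) :
    T u v w = u 0 * T (EuclideanSpace.single 0 1) v w + u 1 * T (EuclideanSpace.single 1 1) v w := by
  rw [Plane.clm_expand T u v]
  rfl

/-- The Gram determinant of two vectors. -/
def gram (B : Plane →L[ℝ] Plane →L[ℝ] ℝ) (a b : Plane) : ℝ := B a a * B b b - B a b ^ 2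

/-- The determinant of two vectors of the plane. -/
def cross (a b : Plane) : ℝ := a 0 * b 1 - a 1 * b 0

/-- A change of basis multiplies the Gram determinant by the square of its determinant. Hence the
vanishing order of λ may be read off in any constant frame. -/
lemma gram_eq_cross_sq_mul {B : Plane →L[ℝ] Plane →L[ℝ] ℝ} (hB : ∀ v w, B v w = B w v)
    (a b : Plane) : gram B a b = cross a b ^ 2 *
      gram B (EuclideanSpace.single 0 1) (EuclideanSpace.single 1 1) := by
  unfold gram cross
  rw [Plane.bilin_expand B a a, Plane.bilin_expand B b b, Plane.bilin_expand B a b,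
    hB (EuclideanSpace.single 1 1) (EuclideanSpace.single 0 1)]
  ring

/-- Cramer's rule, cleared of denominators. -/
lemma cross_smul_eq (a b v : Plane) : cross a b • v = cross v b • a + cross a v • b := by
  ext i
  fin_cases i <;> simp [cross] <;> ring

lemma exists_null_iff_gram_eq_zero {B : Plane →L[ℝ] Plane →L[ℝ] ℝ} (hB : ∀ v w, B v w = B w v)
    {a b : Plane} (hab : cross a b ≠ 0) :
    (∃ v : Plane, v ≠ 0 ∧ ∀ w, B v w = 0) ↔ gram B a b = 0 := by
  have expand : ∀ v w, cross a b * B w v = cross v b * B w a + cross a v * B w b := fun v w ↦ by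
    have := congrArg (B w) (cross_smul_eq a b v)
    simpa using this
  have ha : a ≠ 0 := by rintro rfl; simp [cross] at hab
  constructor
  · rintro ⟨v, hv0, hv⟩
    by_contra h
    have h1 := expand v a
    have h2 := expand v b
    rw [hB a v, hv] at h1
    rw [hB b v, hv, hB b a] at h2
    have h3 : cross v b * gram B a b = 0 := by
      unfold gram; linear_combination (-B b b) * h1 + B a b * h2
    have h4 : cross a v * gram B a b = 0 := by
      unfold gram; linear_combination (-B a a) * h2 + B a b * h1
    have h5 := cross_smul_eq a b v
    rw [(mul_eq_zero.1 h3).resolve_right h, (mul_eq_zero.1 h4).resolve_right h] at h5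
    simp [hab, hv0] at h5
  · intro h
    have null : ∀ v, B v a = 0 → B v b = 0 → ∀ w, B v w = 0 := fun v h1 h2 w ↦ by
      have := expand w v
      rw [h1, h2] at this
      simpa [hab] using this
    by_cases h0 : B a a = 0 ∧ B a b = 0
    · exact ⟨a, ha, null a h0.1 h0.2⟩
    -- This is B a a times the part of b orthogonal to a; its pairing with b is the Gram
    -- determinant, which vanishes. It is zero only if B a a = B a b = 0, the case where a itself is
    -- null.
    · refine ⟨B a a • b - B a b • a, fun hz ↦ h0 ?_, null _ ?_ ?_⟩
      · have e1 : cross a (B a a • b - B a b • a) = B a a * cross a b := by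
          simp [cross]; ring
        have e2 : cross (B a a • b - B a b • a) b = - B a b * cross a b := by
          simp [cross]; ring
        rw [hz] at e1 e2
        simp [cross] at e1 e2
        unfold cross at hab
        exact ⟨e1.resolve_right hab, e2.resolve_right hab⟩
      · simp [hB b a]; ring
      · simp only [map_sub, map_smul, sub_apply, smul_apply, smul_eq_mul]
        unfold gram at h
        linear_combination h

/-! ### The metric determinant and the covariant acceleration in a chart -/

namespace PosSemidefMetric

variable {M : Type*} [TopologicalSpace M] [ChartedSpace Plane M] [IsManifold (𝓡 2) ∞ M]
  (g : PosSemidefMetric M) {φ φ' : OpenPartialHomeomorph M Plane} {γ : ℝ → M} {J : Set ℝ} {t : ℝ}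

lemma gramDet_eq_gram (x : Plane) : g.gramDet φ x =
    gram (g.chartForm φ x) (EuclideanSpace.single 0 1) (EuclideanSpace.single 1 1) := by
  unfold gramDet gram
  rw [Matrix.det_fin_two]
  simp only [coeff_eq_chartForm]
  rw [g.chartForm_symm x (EuclideanSpace.single 1 1) (EuclideanSpace.single 0 1)]
  ring

lemma gram_chartForm (x a b : Plane) :
    gram (g.chartForm φ x) a b = cross a b ^ 2 * g.gramDet φ x := by
  rw [gramDet_eq_gram, gram_eq_cross_sq_mul (g.chartForm_symm x)]

lemma isSingular_iff_gramDet (hφ : φ ∈ IsManifold.maximalAtlas (𝓡 2) ∞ M) {q : M}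
    (hq : q ∈ φ.source) : g.IsSingular q ↔ g.gramDet φ (φ q) = 0 := by
  rw [g.isSingular_iff hφ hq, gramDet_eq_gram,
    exists_null_iff_gram_eq_zero (g.chartForm_symm _)]
  simp [cross]

lemma pd_coeff (hφ : φ ∈ IsManifold.maximalAtlas (𝓡 2) ∞ M) {x : Plane} (hx : x ∈ φ.target)
    (i j l : Fin 2) : pd i (fun y ↦ g.coeff φ y j l) x =
      fderiv ℝ (g.chartForm φ) x (EuclideanSpace.single i 1) (EuclideanSpace.single j 1)
        (EuclideanSpace.single l 1) := by
  rw [← fderiv_clm_apply₂ (g.differentiableAt_chartForm hφ hx)]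
  rfl

/-- Lowering the index cancels the inverse matrix in the Christoffel symbols. This needs a
nonsingular point, since only there is the matrix inverse a true inverse. -/
lemma accelInner_chartAt (hJ : UniqueDiffOn ℝ J) (hγ : ContMDiffOn 𝓘(ℝ, ℝ) (𝓡 2) ∞ γ J)
    (htJ : t ∈ J) (hs : ¬ g.IsSingular (γ t)) (n : TangentSpace (𝓡 2) (γ t)) :
    g.accelInner γ J t n = accelPairing (g.chartForm (chartAt Plane (γ t)))
      (chartAt Plane (γ t) (γ t)) (chartVelocity (chartAt Plane (γ t)) γ J t)
      (chartAccel (chartAt Plane (γ t)) γ J t) (chartDeriv (chartAt Plane (γ t)) (γ t) n) := by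
  have hq := mem_chart_source Plane (γ t)
  have hφ : chartAt Plane (γ t) ∈ IsManifold.maximalAtlas (𝓡 2) ∞ M :=
    IsManifold.chart_mem_maximalAtlas _
  change (∑ k, ∑ l, g.coeff (chartAt Plane (γ t)) (chartAt Plane (γ t) (γ t)) k l *
    g.accelComponent γ J (chartAt Plane (γ t)) k t *
      (chartDeriv (chartAt Plane (γ t)) (γ t) n) l) = _
  generalize chartAt Plane (γ t) = φ at hq hφ ⊢
  generalize chartDeriv φ (γ t) n = ν
  have hx := φ.map_source hq
  rw [g.isSingular_iff_gramDet hφ hq] at hs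
  have hinv : g.coeff φ (φ (γ t)) * (g.coeff φ (φ (γ t)))⁻¹ = 1 :=
    Matrix.mul_nonsing_inv _ (isUnit_iff_ne_zero.2 hs)
  unfold accelPairing christoffelFirst accelComponent christoffel
  simp only [derivWithin_derivWithin_chart_coord hφ hJ hγ htJ hq,
    derivWithin_chart_coord hφ hJ (hγ t htJ) htJ hq, g.pd_coeff hφ hx]
  rw [Plane.bilin_expand (g.chartForm φ (φ (γ t)))]
  generalize chartVelocity φ γ J t = v
  generalize chartAccel φ γ J t = a
  simp only [← coeff_eq_chartForm]
  have hsymm : g.coeff φ (φ (γ t)) 1 0 = g.coeff φ (φ (γ t)) 0 1 := g.chartForm_symm _ _ _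
  have fsymm := g.fderiv_chartForm_symm hφ hx
  generalize g.coeff φ (φ (γ t)) = C at *
  generalize C⁻¹ = I at *
  generalize fderiv ℝ (g.chartForm φ) (φ (γ t)) = T at *
  have h00 := congrFun (congrFun hinv 0) 0
  have h01 := congrFun (congrFun hinv 0) 1
  have h10 := congrFun (congrFun hinv 1) 0
  have h11 := congrFun (congrFun hinv 1) 1
  simp only [Matrix.mul_apply, Fin.sum_univ_two, Matrix.one_apply, hsymm] at h00 h01 h10 h11
  norm_num at h00 h01 h10 h11
  simp only [Fin.sum_univ_two, hsymm]
  rw [Plane.trilin_expand T v v ν, Plane.trilin_expand T ν v v,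
    Plane.bilin_expand (T _) v ν, Plane.bilin_expand (T _) v ν, Plane.bilin_expand (T _) v v,
    Plane.bilin_expand (T _) v v]
  simp only [fsymm _ (EuclideanSpace.single 1 1) (EuclideanSpace.single 0 1)]
  generalize T (EuclideanSpace.single 0 1) (EuclideanSpace.single 0 1)
    (EuclideanSpace.single 0 1) = d000
  generalize T (EuclideanSpace.single 0 1) (EuclideanSpace.single 0 1)
    (EuclideanSpace.single 1 1) = d001
  generalize T (EuclideanSpace.single 0 1) (EuclideanSpace.single 1 1)
    (EuclideanSpace.single 1 1) = d011
  generalize T (EuclideanSpace.single 1 1) (EuclideanSpace.single 0 1)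
    (EuclideanSpace.single 0 1) = d100
  generalize T (EuclideanSpace.single 1 1) (EuclideanSpace.single 0 1)
    (EuclideanSpace.single 1 1) = d101
  generalize T (EuclideanSpace.single 1 1) (EuclideanSpace.single 1 1)
    (EuclideanSpace.single 1 1) = d111
  -- The two factors are the lowered Christoffel symbols Γ(v, v, ∂₀) and Γ(v, v, ∂₁); each
  -- multiplies the entries of C · C⁻¹ = 1 contracted with ν.
  linear_combination
    (1 / 2 * (d000 * v 0 ^ 2 + 2 * d100 * v 0 * v 1 + (2 * d101 - d011) * v 1 ^ 2))
      * (ν 0 * h00 + ν 1 * h10)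
    + (1 / 2 * ((2 * d001 - d100) * v 0 ^ 2 + 2 * d011 * v 0 * v 1 + d111 * v 1 ^ 2))
      * (ν 0 * h01 + ν 1 * h11)

/-- The covariant acceleration may be computed in any chart. -/
lemma accelInner_eq (hφ : φ ∈ IsManifold.maximalAtlas (𝓡 2) ∞ M)
    (hJ : UniqueDiffOn ℝ J) (hγ : ContMDiffOn 𝓘(ℝ, ℝ) (𝓡 2) ∞ γ J)
    (htJ : t ∈ J) (ht : γ t ∈ φ.source) (hs : ¬ g.IsSingular (γ t))
    (n : TangentSpace (𝓡 2) (γ t)) :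
    g.accelInner γ J t n = accelPairing (g.chartForm φ) (φ (γ t)) (chartVelocity φ γ J t)
      (chartAccel φ γ J t) (chartDeriv φ (γ t) n) :=
  (g.accelInner_chartAt hJ hγ htJ hs n).trans
    (g.accelPairing_transition hφ (IsManifold.chart_mem_maximalAtlas _) hJ hγ htJ ht
      (mem_chart_source Plane (γ t)) n)

lemma speed_eq (hφ : φ ∈ IsManifold.maximalAtlas (𝓡 2) ∞ M)
    (hJ : UniqueDiffOn ℝ J) (hγ : ContMDiffWithinAt 𝓘(ℝ, ℝ) (𝓡 2) ∞ γ J t)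
    (htJ : t ∈ J) (ht : γ t ∈ φ.source) :
    g.speed γ J t =
      √(g.chartForm φ (φ (γ t)) (chartVelocity φ γ J t) (chartVelocity φ γ J t)) := by
  rw [chartVelocity_eq hφ hJ hγ htJ ht, g.chartForm_chartDeriv hφ ht]
  rfl

end PosSemidefMetric

/-! ### Bilinear forms along a curve -/

section

variable {E : Type*} [NormedAddCommGroup E] [NormedSpace ℝ E]

lemma ContDiffOn.clm_clm_apply {F H K : Type*} [NormedAddCommGroup F] [NormedSpace ℝ F]
    [NormedAddCommGroup H] [NormedSpace ℝ H] [NormedAddCommGroup K] [NormedSpace ℝ K]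
    {L : ℝ → F →L[ℝ] H →L[ℝ] K} {v : ℝ → F} {w : ℝ → H} {J : Set ℝ}
    (hL : ContDiffOn ℝ ∞ L J) (hv : ContDiffOn ℝ ∞ v J) (hw : ContDiffOn ℝ ∞ w J) :
    ContDiffOn ℝ ∞ (fun t ↦ L t (v t) (w t)) J :=
  (hL.clm_apply hv).clm_apply hw

lemma ContDiffOn.comp_curve {F : Type*} [NormedAddCommGroup F] [NormedSpace ℝ F]
    {G : E → F} {U : Set E} {x : ℝ → E} {J : Set ℝ} (hG : ContDiffOn ℝ ∞ G U)
    (hx : ContDiffOn ℝ ∞ x J) (hxU : MapsTo x J U) : ContDiffOn ℝ ∞ (fun t ↦ G (x t)) J :=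
  hG.comp hx hxU

lemma ContDiffOn.fderiv_curve_apply {F : Type*} [NormedAddCommGroup F] [NormedSpace ℝ F]
    {G : E → F} {U : Set E} {x a : ℝ → E} {J : Set ℝ} (hG : ContDiffOn ℝ ∞ G U) (hU : IsOpen U)
    (hx : ContDiffOn ℝ ∞ x J) (hxU : MapsTo x J U) (ha : ContDiffOn ℝ ∞ a J) :
    ContDiffOn ℝ ∞ (fun t ↦ fderiv ℝ G (x t) (a t)) J :=
  ((hG.fderiv_of_isOpen hU (by simp)).comp_curve hx hxU).clm_apply ha

lemma contDiffOn_christoffelFirst {G : E → E →L[ℝ] E →L[ℝ] ℝ} {U : Set E} (hU : IsOpen U)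
    (hG : ContDiffOn ℝ ∞ G U) {x a b c : ℝ → E} {J : Set ℝ} (hx : ContDiffOn ℝ ∞ x J)
    (hxU : MapsTo x J U) (ha : ContDiffOn ℝ ∞ a J) (hb : ContDiffOn ℝ ∞ b J)
    (hc : ContDiffOn ℝ ∞ c J) :
    ContDiffOn ℝ ∞ (fun t ↦ christoffelFirst G (x t) (a t) (b t) (c t)) J := by
  have h : ∀ {a b c : ℝ → E}, ContDiffOn ℝ ∞ a J → ContDiffOn ℝ ∞ b J → ContDiffOn ℝ ∞ c J →
      ContDiffOn ℝ ∞ (fun t ↦ fderiv ℝ G (x t) (a t) (b t) (c t)) J := fun ha hb hc ↦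
    (hG.fderiv_curve_apply hU hx hxU ha).clm_clm_apply hb hc
  exact contDiffOn_const.mul (((h ha hb hc).add (h hb ha hc)).sub (h hc ha hb))

lemma HasDerivWithinAt.bilin_comp_apply {G : E → E →L[ℝ] E →L[ℝ] ℝ} {x w : ℝ → E} {x' w' : E}
    {J : Set ℝ} {t : ℝ} (hx : HasDerivWithinAt x x' J t) (hG : DifferentiableAt ℝ G (x t))
    (a : E) (hw : HasDerivWithinAt w w' J t) :
    HasDerivWithinAt (fun s ↦ G (x s) a (w s))
      (fderiv ℝ G (x t) x' a (w t) + G (x t) a w') J t := by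
  have h1 := hx.clm_comp_apply hG (hasDerivWithinAt_const t J a)
  simpa using h1.clm_apply hw

lemma clm_map_smul_add {F H : Type*} [NormedAddCommGroup F] [NormedSpace ℝ F]
    [NormedAddCommGroup H] [NormedSpace ℝ H] (T : E →L[ℝ] F →L[ℝ] H) (r s : ℝ) (p q : E) (v : F) :
    T (r • p + s • q) v = r • T p v + s • T q v := by
  simp

/-- The geodesic curvature as the sum of the angular velocity with respect to an orthonormal frame
and the connection form of the frame, cleared of denominators. -/
lemma accelPairing_rotation {G : E → E →L[ℝ] E →L[ℝ] ℝ} {x : E}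
    (hs : ∀ v w, G x v w = G x w v)
    (hT : ∀ a b c, fderiv ℝ G x a b c = fderiv ℝ G x a c b) {e f v a : E} {p q c d : ℝ}
    (hv : v = p • e + q • f) (ha : a = c • e + d • f) :
    G x e e * accelPairing G x v a (-(G x v f) • e + G x v e • f) =
      G x e v * ((fderiv ℝ G x v e e * G x f f + G x e e * fderiv ℝ G x v f f
          - 2 * G x e f * fderiv ℝ G x v e f) * q / 2
        + (G x e e * G x f f - G x e f ^ 2) * d)
      - (G x e e * G x f f - G x e f ^ 2) * q * (fderiv ℝ G x v e v + G x e a)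
      + G x v v * (G x e e * christoffelFirst G x v e f - G x e f * christoffelFirst G x v e e) := by
  unfold accelPairing christoffelFirst
  have h1 : ∀ r s : ℝ, ∀ y z w : E, G x (r • y + s • z) w = r * G x y w + s * G x z w :=
    fun r s y z w ↦ by simp
  have h2 : ∀ r s : ℝ, ∀ y z w : E, G x w (r • y + s • z) = r * G x w y + s * G x w z :=
    fun r s y z w ↦ by simp
  have h3 : ∀ r s : ℝ, ∀ y z w u : E, fderiv ℝ G x (r • y + s • z) w u =
      r * fderiv ℝ G x y w u + s * fderiv ℝ G x z w u := fun r s y z w u ↦ by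
    rw [clm_map_smul_add]; simp
  have h4 : ∀ r s : ℝ, ∀ y z w u : E, fderiv ℝ G x u (r • y + s • z) w =
      r * fderiv ℝ G x u y w + s * fderiv ℝ G x u z w := fun r s y z w u ↦ by
    rw [clm_map_smul_add]; simp
  have h5 : ∀ r s : ℝ, ∀ y z w u : E, fderiv ℝ G x u w (r • y + s • z) =
      r * fderiv ℝ G x u w y + s * fderiv ℝ G x u w z := fun r s y z w u ↦ by
    rw [hT, h4, hT u y, hT u z]
  subst hv ha
  simp only [h1, h2, h3, h4, h5]
  rw [hs f e, hT e f e, hT f f e]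
  ring

end

lemma contDiff_cross_right (e : Plane) : ContDiff ℝ ∞ (cross e) := by
  unfold cross
  fun_prop

lemma eq_smul_add_smul {e f : Plane} (hef : cross e f ≠ 0) (v : Plane) :
    v = (cross v f / cross e f) • e + (cross e v / cross e f) • f := by
  have h := cross_smul_eq e f v
  have h2 := congrArg (fun w ↦ (cross e f)⁻¹ • w) h
  simp only [smul_add, smul_smul, inv_mul_cancel₀ hef, one_smul] at h2
  rw [div_eq_inv_mul, div_eq_inv_mul]
  exact h2

/-- The splitting of `B v v` with respect to the orthogonal frame obtained from `e` and `f`. -/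
lemma sq_add_gram_mul_sq {B : Plane →L[ℝ] Plane →L[ℝ] ℝ} (hB : ∀ v w, B v w = B w v)
    {e f v : Plane} (hef : cross e f ≠ 0) :
    B e v ^ 2 + gram B e f * (cross e v / cross e f) ^ 2 = B e e * B v v := by
  have hv := eq_smul_add_smul hef v
  generalize cross e v / cross e f = q at hv ⊢
  generalize cross v f / cross e f = p at hv
  subst hv
  unfold gram
  simp only [map_add, map_smul, add_apply, smul_apply, smul_eq_mul]
  rw [hB f e]
  ring

/-- Along the curve this yields positivity from E > 0 and l > 0 alone, because `sq_add_gram_mul_sq`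
splits E ⟨v,v⟩ into two squares that cannot both vanish. -/
lemma Plane.form_pos {B : Plane →L[ℝ] Plane →L[ℝ] ℝ} (hB : ∀ v w, B v w = B w v)
    {e f v : Plane} (hef : cross e f ≠ 0) (hE : 0 < B e e) (hl : 0 < gram B e f) (hv : v ≠ 0) :
    0 < B v v := by
  have h := sq_add_gram_mul_sq hB (v := v) hef
  have hpos : 0 < B e v ^ 2 + gram B e f * (cross e v / cross e f) ^ 2 := by
    by_cases hq : cross e v / cross e f = 0
    · have hv' := eq_smul_add_smul hef v
      rw [hq, zero_smul, add_zero] at hv'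
      have hp : cross v f / cross e f ≠ 0 := fun hp ↦ hv (by rw [hv', hp, zero_smul])
      have : B e v ≠ 0 := by
        rw [hv', map_smul, smul_eq_mul]
        exact mul_ne_zero hp hE.ne'
      positivity
    · positivity
  rw [h] at hpos
  exact pos_of_mul_pos_right hpos hE.le

/-- The limit of the geodesic curvature measure of a curve that starts at a point where the metric
`G` degenerates in the direction `f` only, the Christoffel symbols of the first kind vanish in this
direction, and the Gram determinant vanishes exactly to second order along the curve. -/
lemma exists_tendsto_accelPairing {G : Plane → Plane →L[ℝ] Plane →L[ℝ] ℝ} {U : Set Plane}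
    (hU : IsOpen U) (hG : ContDiffOn ℝ ∞ G U) (hs : ∀ x v w, G x v w = G x w v)
    {x : ℝ → Plane} {δ : ℝ} (hδ : 0 < δ) (hx : ContDiffOn ℝ ∞ x (Ico 0 δ))
    (hxU : MapsTo x (Ico 0 δ) U) {e f : Plane} (hef : cross e f ≠ 0) (hE : 0 < G (x 0) e e)
    (hf : ∀ w, G (x 0) f w = 0) (hΓ : ∀ a b, christoffelFirst G (x 0) a b f = 0)
    (hl1 : derivWithin (fun t ↦ gram (G (x t)) e f) (Ico 0 δ) 0 = 0)
    (hl2 : 0 < derivWithin (derivWithin (fun t ↦ gram (G (x t)) e f) (Ico 0 δ)) (Ico 0 δ) 0)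
    (hv : derivWithin x (Ico 0 δ) 0 ≠ 0) {x' x'' : ℝ → Plane}
    (hx' : x' = derivWithin x (Ico 0 δ)) (hx'' : x'' = derivWithin x' (Ico 0 δ)) :
    ∃ L, Tendsto (fun t ↦ accelPairing G (x t) (x' t) (x'' t)
        (-(G (x t) (x' t) f) • e + G (x t) (x' t) e • f) /
          (√(gram (G (x t)) e f) * G (x t) (x' t) (x' t))) (𝓝[>] 0) (𝓝 L) := by
  have sx' : ContDiffOn ℝ ∞ x' (Ico 0 δ) := hx' ▸ hx.derivWithin_Ico
  have sx'' : ContDiffOn ℝ ∞ x'' (Ico 0 δ) := hx'' ▸ sx'.derivWithin_Ico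
  have sG : ContDiffOn ℝ ∞ (fun t ↦ G (x t)) (Ico 0 δ) := hG.comp_curve hx hxU
  have sGc : ∀ a b, ContDiffOn ℝ ∞ (fun t ↦ G (x t) a b) (Ico 0 δ) := fun a b ↦
    sG.clm_clm_apply contDiffOn_const contDiffOn_const
  have sl : ContDiffOn ℝ ∞ (fun t ↦ gram (G (x t)) e f) (Ico 0 δ) :=
    ((sGc e e).mul (sGc f f)).sub ((sGc e f).pow 2)
  have sP : ContDiffOn ℝ ∞ (fun t ↦ G (x t) e (x' t)) (Ico 0 δ) :=
    sG.clm_clm_apply contDiffOn_const sx'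
  have sc : ∀ {y : ℝ → Plane}, ContDiffOn ℝ ∞ y (Ico 0 δ) →
      ContDiffOn ℝ ∞ (fun t ↦ cross e (y t) / cross e f) (Ico 0 δ) := fun hy ↦
    ((contDiff_cross_right e).comp_contDiffOn hy).div_const _
  have sΓ : ∀ c, ContDiffOn ℝ ∞ (fun t ↦ christoffelFirst G (x t) (x' t) e c) (Ico 0 δ) := fun c ↦
    contDiffOn_christoffelFirst hU hG hx hxU sx' contDiffOn_const contDiffOn_const
  have hF0 : G (x 0) e f = 0 := by rw [hs, hf]
  have hl0 : gram (G (x 0)) e f = 0 := by simp [gram, hF0, hf]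
  have tl := sl.tendsto_nhdsGT hδ
  have tl' := sl.derivWithin_Ico.tendsto_nhdsGT hδ
  rw [hl0] at tl
  rw [hl1] at tl'
  obtain ⟨L₁, hL₁⟩ := exists_tendsto_angularVelocity
    (sP.eventually_hasDerivAt_derivWithin hδ)
    (sP.derivWithin_Ico.eventually_hasDerivAt_derivWithin hδ)
    (sl.eventually_hasDerivAt_derivWithin hδ)
    (sl.derivWithin_Ico.eventually_hasDerivAt_derivWithin hδ)
    (sl.derivWithin_Ico.derivWithin_Ico.eventually_hasDerivAt_derivWithin hδ)
    (sP.tendsto_nhdsGT hδ) (sP.derivWithin_Ico.tendsto_nhdsGT hδ)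
    (sP.derivWithin_Ico.derivWithin_Ico.tendsto_nhdsGT hδ)
    ((sc sx').tendsto_nhdsGT hδ) ((sc sx'').tendsto_nhdsGT hδ) tl tl'
    (sl.derivWithin_Ico.derivWithin_Ico.tendsto_nhdsGT hδ)
    (sl.derivWithin_Ico.derivWithin_Ico.derivWithin_Ico.tendsto_nhdsGT hδ) hl2 (by
      -- If the f-component of x'(0) is zero, then x'(0) is a multiple of e; P(0) = 0 and E > 0 make
      -- it zero, against regularity.
      intro hP hq
      have hv' := eq_smul_add_smul hef (x' 0)
      rw [hq, zero_smul, add_zero] at hv'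
      rw [hv', map_smul, smul_eq_mul, mul_eq_zero] at hP
      rw [hP.resolve_right hE.ne', zero_smul, hx'] at hv'
      exact hv hv')
  have tl2 := tendsto_div_sq_of_hasDerivAt (sl.eventually_hasDerivAt_derivWithin hδ) tl
    (tendsto_div_id_of_hasDerivAt (sl.derivWithin_Ico.eventually_hasDerivAt_derivWithin hδ) tl'
      (sl.derivWithin_Ico.derivWithin_Ico.tendsto_nhdsGT hδ))
  have tr := (Real.continuous_sqrt.tendsto _).comp tl2
  have tF := (sGc e f).tendsto_nhdsGT hδ
  rw [hF0] at tF
  have tF1 := tendsto_div_id_of_hasDerivAt ((sGc e f).eventually_hasDerivAt_derivWithin hδ) tF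
    ((sGc e f).derivWithin_Ico.tendsto_nhdsGT hδ)
  have tc := (sΓ f).tendsto_nhdsGT hδ
  rw [hΓ] at tc
  have tc1 := tendsto_div_id_of_hasDerivAt ((sΓ f).eventually_hasDerivAt_derivWithin hδ) tc
    ((sΓ f).derivWithin_Ico.tendsto_nhdsGT hδ)
  have tE := (sGc e e).tendsto_nhdsGT hδ
  -- The connection form (Γ(x',e,f) − (F/E) Γ(x',e,e)) / √l, with numerator and denominator divided
  -- by t.
  have T2 := (tc1.sub ((tF1.div tE hE.ne').mul ((sΓ e).tendsto_nhdsGT hδ))).div tr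
    (Real.sqrt_pos.2 (by positivity)).ne'
  refine ⟨_, (hL₁.add T2).congr' ?_⟩
  have hv0 : x' 0 ≠ 0 := hx' ▸ hv
  filter_upwards [Ioo_mem_nhdsGT hδ, tE.eventually_const_lt hE,
    tl2.eventually_const_lt (by positivity : (0 : ℝ) < _),
    (sx'.tendsto_nhdsGT hδ).eventually_ne hv0] with t ht hEt hlt hvt
  have htJ : t ∈ Ico 0 δ := Ioo_subset_Ico_self ht
  have ht0 : 0 < t := ht.1
  have hlt' : 0 < gram (G (x t)) e f := by
    rwa [div_pos_iff_of_pos_right (by positivity)] at hlt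
  have hN : 0 < G (x t) (x' t) (x' t) := Plane.form_pos (hs _) hef hEt hlt' hvt
  have hGd : DifferentiableAt ℝ G (x t) :=
    (hG.differentiableOn (by simp)).differentiableAt (hU.mem_nhds (hxU htJ))
  have hT : ∀ a b c, fderiv ℝ G (x t) a b c = fderiv ℝ G (x t) a c b := fun a b c ↦ by
    rw [← fderiv_clm_apply₂ hGd, ← fderiv_clm_apply₂ hGd]
    simp only [hs _ b c]
  have huniq := uniqueDiffOn_Ico 0 δ t htJ
  have hxd : HasDerivWithinAt x (x' t) (Ico 0 δ) t := by
    rw [hx']; exact ((hx.differentiableOn (by simp)) t htJ).hasDerivWithinAt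
  have hxd' : HasDerivWithinAt x' (x'' t) (Ico 0 δ) t := by
    rw [hx'']; exact ((sx'.differentiableOn (by simp)) t htJ).hasDerivWithinAt
  have dP := (hxd.bilin_comp_apply hGd e hxd').derivWithin huniq
  have dG : ∀ a b, HasDerivWithinAt (fun s ↦ G (x s) a b) (fderiv ℝ G (x t) (x' t) a b)
      (Ico 0 δ) t := fun a b ↦ by
    simpa using hxd.bilin_comp_apply hGd a (hasDerivWithinAt_const t _ b)
  have dl : derivWithin (fun t ↦ gram (G (x t)) e f) (Ico 0 δ) t =
      fderiv ℝ G (x t) (x' t) e e * G (x t) f f + G (x t) e e * fderiv ℝ G (x t) (x' t) f f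
          - 2 * G (x t) e f * fderiv ℝ G (x t) (x' t) e f := by
    have := (((dG e e).mul (dG f f)).sub ((dG e f).pow 2)).derivWithin huniq
    refine Eq.trans this ?_
    simp
  have key := accelPairing_rotation (hs (x t)) hT (eq_smul_add_smul hef (x' t))
    (eq_smul_add_smul hef (x'' t))
  rw [← dl, ← dP] at key
  have hden := sq_add_gram_mul_sq (hs (x t)) (v := x' t) hef
  have hr : √(gram (G (x t)) e f / t ^ 2) = √(gram (G (x t)) e f) / t := by
    rw [Real.sqrt_div hlt'.le, Real.sqrt_sq ht0.le]
  have hr2 : √(gram (G (x t)) e f) ^ 2 = gram (G (x t)) e f := Real.sq_sqrt hlt'.le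
  have hrpos := Real.sqrt_pos.2 hlt'
  have hg' : G (x t) e e * G (x t) f f - G (x t) e f ^ 2 = gram (G (x t)) e f := rfl
  rw [hg'] at key
  simp only [Pi.div_apply, Function.comp]
  rw [hr, hden]
  generalize derivWithin (fun t ↦ gram (G (x t)) e f) (Ico 0 δ) t = dl at *
  generalize derivWithin (fun t ↦ G (x t) e (x' t)) (Ico 0 δ) t = dP at *
  -- By `hden` the angular velocity has denominator E ⟨x',x'⟩; multiplying by E brings the claim to
  -- the form of `accelPairing_rotation`, after which l = (√l)² cancels.
  rw [eq_div_iff (by positivity)]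
  refine mul_left_cancel₀ hEt.ne' ?_
  rw [key]
  generalize √(gram (G (x t)) e f) = r at *
  rw [← hr2]
  field_simp

/-! ### Nondegenerate zeros of nonnegative functions -/

/-- Cauchy–Schwarz for a semi-definite form: B a a times the Gram determinant is the square norm of
B a a • b − B a b • a. This is inconclusive when B a a = 0, which is handled separately. -/
lemma gram_nonneg {B : Plane →L[ℝ] Plane →L[ℝ] ℝ} (hB : ∀ v w, B v w = B w v)
    (h0 : ∀ v, 0 ≤ B v v) (a b : Plane) : 0 ≤ gram B a b := by
  have h1 : B a a * gram B a b = B (B a a • b - B a b • a) (B a a • b - B a b • a) := by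
    unfold gram
    simp only [map_sub, map_smul, sub_apply, smul_apply, smul_eq_mul]
    rw [hB b a]; ring
  rcases (h0 a).eq_or_lt with h | h
  -- When B a a = 0 the square norm of b + s a is affine in s; being nonnegative it has slope zero.
  -- The value of s used below would make it −1.
  · have h2 : ∀ s : ℝ, 0 ≤ B b b + 2 * s * B a b := fun s ↦ by
      have := h0 (b + s • a)
      simp only [map_add, map_smul, add_apply, smul_apply, smul_eq_mul, hB b a, ← h] at this
      linarith
    have h3 : B a b = 0 := by
      by_contra hne
      have := h2 (-(B b b + 1) / (2 * B a b))
      field_simp at this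
      linarith
    simp [gram, h3, ← h]
  · exact nonneg_of_mul_nonneg_right (h1 ▸ h0 _) h

lemma null_of_apply_self_eq_zero {B : Plane →L[ℝ] Plane →L[ℝ] ℝ} (hB : ∀ v w, B v w = B w v)
    (h0 : ∀ v, 0 ≤ B v v) {v : Plane} (hv : B v v = 0) (w : Plane) : B v w = 0 := by
  have := gram_nonneg hB h0 v w
  unfold gram at this
  rw [hv] at this
  nlinarith [sq_nonneg (B v w)]

section

variable {E : Type*} [NormedAddCommGroup E] [NormedSpace ℝ E]

lemma tendsto_line_div {f : E → ℝ} {x : E} (hf : DifferentiableAt ℝ f x) (h0 : f x = 0) (v : E) :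
    Tendsto (fun s : ℝ ↦ f (x + s • v) / s) (𝓝[>] 0) (𝓝 (fderiv ℝ f x v)) := by
  have h := (hf.hasFDerivAt.hasLineDerivAt v).tendsto_slope_zero_right
  refine h.congr fun s ↦ ?_
  simp [h0]
  ring

lemma hasDerivAt_line (x v : E) (s : ℝ) : HasDerivAt (fun s : ℝ ↦ x + s • v) v s := by
  simpa using ((hasDerivAt_id s).smul_const v).const_add x

lemma tendsto_line_div_sq {f : E → ℝ} {x : E} (hf : ContDiffAt ℝ ∞ f x) (h0 : f x = 0)
    (h1 : fderiv ℝ f x = 0) (v : E) :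
    Tendsto (fun s : ℝ ↦ f (x + s • v) / s ^ 2) (𝓝[>] 0)
      (𝓝 (fderiv ℝ (fderiv ℝ f) x v v / 2)) := by
  have hc : Tendsto (fun s : ℝ ↦ x + s • v) (𝓝[>] 0) (𝓝 x) := by
    have := (hasDerivAt_line x v 0).continuousAt.tendsto
    simp only [zero_smul, add_zero] at this
    exact this.mono_left nhdsWithin_le_nhds
  have hD : DifferentiableAt ℝ (fderiv ℝ f) x :=
    (hf.fderiv_right (m := 1) (by norm_cast)).differentiableAt (by simp)
  have hD' : HasFDerivAt (fun y ↦ fderiv ℝ f y v) ((fderiv ℝ (fderiv ℝ f) x).flip v) x := by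
    simpa using hD.hasFDerivAt.clm_apply (hasFDerivAt_const v x)
  refine tendsto_div_sq_of_hasDerivAt (f' := fun s ↦ fderiv ℝ f (x + s • v) v) ?_ ?_ ?_
  · have hev : ∀ᶠ y in 𝓝 x, DifferentiableAt ℝ f y := by
      filter_upwards [(hf.of_le (by norm_cast : (1 : ℕ∞ω) ≤ ∞)).eventually (by simp)] with y hy
      exact hy.differentiableAt (by simp)
    filter_upwards [hc.eventually hev] with s hs
    exact hs.hasFDerivAt.comp_hasDerivAt s (hasDerivAt_line x v s)
  · simpa [h0, Function.comp_def] using hf.continuousAt.tendsto.comp hc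
  · have := tendsto_line_div hD'.differentiableAt (by simp [h1]) v
    rwa [hD'.fderiv] at this

end

open PosSemidefMetric in
/-- The Hessian is positive definite at a nondegenerate zero of a nonnegative function. -/
lemma fderiv_fderiv_pos {f : Plane → ℝ} {x : Plane} (hf : ContDiffAt ℝ ∞ f x)
    (hnn : ∀ y, 0 ≤ f y) (h0 : f x = 0)
    (hdet : (Matrix.of fun i j : Fin 2 ↦ pd i (pd j f) x).det ≠ 0) {v : Plane} (hv : v ≠ 0) :
    0 < fderiv ℝ (fderiv ℝ f) x v v := by
  have h1 : fderiv ℝ f x = 0 :=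
    IsLocalMin.fderiv_eq_zero (Eventually.of_forall fun y ↦ by rw [h0]; exact hnn y)
  have hsymm : ∀ a b, fderiv ℝ (fderiv ℝ f) x a b = fderiv ℝ (fderiv ℝ f) x b a :=
    fun a b ↦ (hf.isSymmSndFDerivAt (by simp; norm_cast)) a b
  have hpsd : ∀ w, 0 ≤ fderiv ℝ (fderiv ℝ f) x w w := fun w ↦ by
    have := ge_of_tendsto (tendsto_line_div_sq hf h0 h1 w) (b := 0) (by
      filter_upwards with s
      exact div_nonneg (hnn _) (sq_nonneg s))
    linarith
  have hD : DifferentiableAt ℝ (fderiv ℝ f) x :=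
    (hf.fderiv_right (m := 1) (by norm_cast)).differentiableAt (by simp)
  have hpd : ∀ i j, pd i (pd j f) x = fderiv ℝ (fderiv ℝ f) x (EuclideanSpace.single i 1)
      (EuclideanSpace.single j 1) := fun i j ↦ by
    have h : HasFDerivAt (fun y ↦ fderiv ℝ f y (EuclideanSpace.single j 1))
        ((fderiv ℝ (fderiv ℝ f) x).flip (EuclideanSpace.single j 1)) x := by
      simpa using hD.hasFDerivAt.clm_apply (hasFDerivAt_const (EuclideanSpace.single j 1) x)
    change fderiv ℝ (fun y ↦ fderiv ℝ f y (EuclideanSpace.single j 1)) x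
      (EuclideanSpace.single i 1) = _
    rw [h.fderiv]
    rfl
  -- The Hessian is already semi-definite, so a vector on which its quadratic form vanishes lies in
  -- its kernel and forces its determinant to be zero.
  refine (hpsd v).lt_of_ne fun hz ↦ hdet ?_
  have hnull := (exists_null_iff_gram_eq_zero hsymm (a := EuclideanSpace.single 0 1)
    (b := EuclideanSpace.single 1 1) (by simp [cross])).1
      ⟨v, hv, null_of_apply_self_eq_zero hsymm hpsd hz.symm⟩
  rw [Matrix.det_fin_two]
  simp only [Matrix.of_apply, hpd]
  rw [hsymm (EuclideanSpace.single 1 1) (EuclideanSpace.single 0 1), ← hnull]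
  unfold gram
  ring

/-! ### The metric at an admissible cross cap -/

namespace PosSemidefMetric

variable {M : Type*} [TopologicalSpace M] [ChartedSpace Plane M] [IsManifold (𝓡 2) ∞ M]
  (g : PosSemidefMetric M) {φ : OpenPartialHomeomorph M Plane}

lemma contDiffAt_chartForm_apply (hφ : φ ∈ IsManifold.maximalAtlas (𝓡 2) ∞ M) {x : Plane}
    (hx : x ∈ φ.target) (a b : Plane) : ContDiffAt ℝ ∞ (fun y ↦ g.chartForm φ y a b) x :=
  (((g.contDiffOn_chartForm hφ).contDiffAt (φ.open_target.mem_nhds hx)).clm_apply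
    contDiffAt_const).clm_apply contDiffAt_const

lemma contDiffAt_gramDet (hφ : φ ∈ IsManifold.maximalAtlas (𝓡 2) ∞ M) {x : Plane}
    (hx : x ∈ φ.target) : ContDiffAt ℝ ∞ (g.gramDet φ) x := by
  have e : g.gramDet φ = fun y ↦ gram (g.chartForm φ y) (EuclideanSpace.single 0 1)
    (EuclideanSpace.single 1 1) := funext fun y ↦ g.gramDet_eq_gram y
  rw [e]
  have h := g.contDiffAt_chartForm_apply hφ hx
  exact ((h _ _).mul (h _ _)).sub ((h _ _).pow 2)

lemma gramDet_nonneg (x : Plane) : 0 ≤ g.gramDet φ x := by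
  rw [gramDet_eq_gram]
  exact gram_nonneg (g.chartForm_symm x) (g.chartForm_nonneg x) _ _

/-- At an admissible singular point with nondegenerate Hessian, the metric does not vanish. -/
lemma exists_chartForm_pos (hg : g.Admissible) (hφ : φ ∈ IsManifold.maximalAtlas (𝓡 2) ∞ M)
    {p : M} (hp : p ∈ φ.source)
    (hH : ∀ v, v ≠ 0 → 0 < fderiv ℝ (fderiv ℝ (g.gramDet φ)) (φ p) v v)
    (h0 : g.gramDet φ (φ p) = 0) : ∃ e, 0 < g.chartForm φ (φ p) e e := by
  by_contra hcon
  push Not at hcon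
  have hx := φ.map_source hp
  have hnull : ∀ v w, g.chartForm φ (φ p) v w = 0 := fun v w ↦
    null_of_apply_self_eq_zero (g.chartForm_symm _) (g.chartForm_nonneg _)
      (le_antisymm (hcon v) (g.chartForm_nonneg _ v)) w
  -- If every vector is null, both Γ(a,b,c) and Γ(a,c,b) vanish, and their sum is the derivative of
  -- ⟨b,c⟩ in the direction a.
  have hT : ∀ a b c, b ≠ 0 → c ≠ 0 → fderiv ℝ (g.chartForm φ) (φ p) a b c = 0 := by
    intro a b c hb hc
    have h1 := g.christoffelFirst_chartForm_eq_zero hg hφ hp hc (hnull c) a b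
    have h2 := g.christoffelFirst_chartForm_eq_zero hg hφ hp hb (hnull b) a c
    unfold christoffelFirst at h1 h2
    have s1 := g.fderiv_chartForm_symm hφ hx a b c
    have s2 := g.fderiv_chartForm_symm hφ hx b a c
    have s3 := g.fderiv_chartForm_symm hφ hx c a b
    linarith
  have hd := g.differentiableAt_chartForm hφ hx
  have ht : ∀ i j : Fin 2, Tendsto (fun s : ℝ ↦ g.chartForm φ (φ p + s • EuclideanSpace.single 0 1)
      (EuclideanSpace.single i 1) (EuclideanSpace.single j 1) / s) (𝓝[>] 0) (𝓝 0) := by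
    intro i j
    have := tendsto_line_div
      ((g.contDiffAt_chartForm_apply hφ hx (EuclideanSpace.single i 1)
        (EuclideanSpace.single j 1)).differentiableAt (by simp)) (hnull _ _)
        (EuclideanSpace.single 0 1)
    rwa [fderiv_clm_apply₂ hd, hT _ _ _ (by simp) (by simp)] at this
  have hmin : fderiv ℝ (g.gramDet φ) (φ p) = 0 :=
    IsLocalMin.fderiv_eq_zero (Eventually.of_forall fun y ↦ by rw [h0]; exact g.gramDet_nonneg y)
  have l1 := tendsto_line_div_sq (g.contDiffAt_gramDet hφ hx) h0 hmin (EuclideanSpace.single 0 1)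
  -- All coefficients are o(s) along the line, so λ is o(s²), while `l1` gives half the positive
  -- second derivative as the limit of λ / s².
  have l2 := ((ht 0 0).mul (ht 1 1)).sub ((ht 0 1).pow 2)
  have := tendsto_nhds_unique l1 (l2.congr fun s ↦ by
    rw [gramDet_eq_gram]; unfold gram; ring)
  have hpos := hH (EuclideanSpace.single 0 1) (by simp)
  simp at this
  linarith

end PosSemidefMetric

/-! ### Continuity along the curve and the unit normal -/

lemma accelPairing_smul {E : Type*} [NormedAddCommGroup E] [NormedSpace ℝ E]
    (G : E → E →L[ℝ] E →L[ℝ] ℝ) (x v a w : E) (r : ℝ) :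
    accelPairing G x v a (r • w) = r * accelPairing G x v a w := by
  have h : fderiv ℝ G x (r • w) v v = r * fderiv ℝ G x w v v := by
    have := clm_map_smul_add (fderiv ℝ G x) r 0 w 0 v
    rw [smul_zero, add_zero, zero_smul, add_zero] at this
    rw [this]
    rfl
  unfold accelPairing christoffelFirst
  rw [h]
  simp only [map_smul, smul_eq_mul]
  ring

lemma ContinuousWithinAt.clm_clm_apply {X F H K : Type*} [TopologicalSpace X]
    [NormedAddCommGroup F] [NormedSpace ℝ F]
    [NormedAddCommGroup H] [NormedSpace ℝ H] [NormedAddCommGroup K] [NormedSpace ℝ K]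
    {L : X → F →L[ℝ] H →L[ℝ] K} {v : X → F} {w : X → H} {J : Set X} {t : X}
    (hL : ContinuousWithinAt L J t) (hv : ContinuousWithinAt v J t)
    (hw : ContinuousWithinAt w J t) : ContinuousWithinAt (fun s ↦ L s (v s) (w s)) J t :=
  (hL.clm_apply hv).clm_apply hw

lemma ContinuousWithinAt.fderiv_curve_apply {X E F : Type*} [TopologicalSpace X]
    [NormedAddCommGroup E] [NormedSpace ℝ E] [NormedAddCommGroup F] [NormedSpace ℝ F]
    {G : E → F} {U : Set E} {x a : X → E} {J : Set X} {t : X} (hG : ContDiffOn ℝ ∞ G U)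
    (hU : IsOpen U) (hx : ContinuousWithinAt x J t) (hxU : x t ∈ U)
    (ha : ContinuousWithinAt a J t) : ContinuousWithinAt (fun s ↦ fderiv ℝ G (x s) (a s)) J t :=
  ((((hG.fderiv_of_isOpen (m := ∞) hU (by simp)).continuousOn.continuousAt
    (hU.mem_nhds hxU))).comp_continuousWithinAt hx).clm_apply ha

lemma continuousWithinAt_accelPairing {X E : Type*} [TopologicalSpace X] [NormedAddCommGroup E]
    [NormedSpace ℝ E] {G : E → E →L[ℝ] E →L[ℝ] ℝ} {U : Set E} (hU : IsOpen U)
    (hG : ContDiffOn ℝ ∞ G U) {x v a w : X → E} {J : Set X} {t : X}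
    (hx : ContinuousWithinAt x J t) (hxU : x t ∈ U) (hv : ContinuousWithinAt v J t)
    (ha : ContinuousWithinAt a J t) (hw : ContinuousWithinAt w J t) :
    ContinuousWithinAt (fun s ↦ accelPairing G (x s) (v s) (a s) (w s)) J t := by
  have hGx : ContinuousWithinAt (fun s ↦ G (x s)) J t :=
    (hG.continuousOn.continuousAt (hU.mem_nhds hxU)).comp_continuousWithinAt hx
  have hv1 := ContinuousWithinAt.fderiv_curve_apply hG hU hx hxU hv
  have hw1 := ContinuousWithinAt.fderiv_curve_apply hG hU hx hxU hw
  have h1 := hv1.clm_clm_apply hv hw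
  exact (hGx.clm_clm_apply ha hw).add
    (continuousWithinAt_const.mul ((h1.add h1).sub (hw1.clm_clm_apply hv hv)))

/-- A unit normal vector is, up to sign, the normalized rotation of the tangent vector. -/
lemma eq_smul_rotation {B : Plane →L[ℝ] Plane →L[ℝ] ℝ} (hB : ∀ v w, B v w = B w v)
    {e f v ν : Plane} (hef : cross e f ≠ 0) (hE : 0 < B e e) (hl : 0 < gram B e f)
    (hv : v ≠ 0) (hν : B ν ν = 1) (hνv : B ν v = 0) {m : Plane}
    (hm : m = -(B v f) • e + B v e • f) :
    ν = (B ν m / (√(gram B e f) * √(B v v)) / (√(gram B e f) * √(B v v))) • m ∧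
      (B ν m / (√(gram B e f) * √(B v v))) ^ 2 = 1 := by
  have hN := Plane.form_pos hB hef hE hl hv
  have hmv : B v m = 0 := by
    rw [hm]; simp; ring
  have hmm : B m m = gram B e f * B v v := by
    have h := eq_smul_add_smul hef v
    generalize cross v f / cross e f = p at h
    generalize cross e v / cross e f = q at h
    subst h
    rw [hm]
    simp only [map_add, map_smul, add_apply, smul_apply, smul_eq_mul]
    rw [hB f e]
    unfold gram
    ring
  have hmpos : 0 < B m m := by rw [hmm]; positivity
  have hcr : cross v m ≠ 0 := by
    intro h
    have := gram_eq_cross_sq_mul hB v m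
    rw [h] at this
    unfold gram at this
    rw [hmv] at this
    have : B v v * B m m = 0 := by linarith
    exact (mul_pos hN hmpos).ne' this
  have hnotnull : ¬ ∃ w : Plane, w ≠ 0 ∧ ∀ z, B w z = 0 := by
    rw [exists_null_iff_gram_eq_zero hB hef]; exact hl.ne'
  have hsq : (√(gram B e f) * √(B v v)) ^ 2 = B m m := by
    rw [mul_pow, Real.sq_sqrt hl.le, Real.sq_sqrt hN.le, hmm]
  have hspos : 0 < √(gram B e f) * √(B v v) := by positivity
  generalize √(gram B e f) * √(B v v) = r at *
  -- The difference of ν and its projection to m is orthogonal to both m and v, which form a basis;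
  -- it is null, hence zero by nondegeneracy.
  have heq : ν = (B ν m / r / r) • m := by
    have hc : B ν m / r / r = B ν m / B m m := by rw [← hsq]; field_simp
    rw [hc]
    by_contra hne
    refine hnotnull ⟨ν - (B ν m / B m m) • m, sub_ne_zero.2 hne, fun z ↦ ?_⟩
    have hz := eq_smul_add_smul hcr z
    rw [hz]
    simp only [map_add, map_smul, map_sub, sub_apply, smul_apply, smul_eq_mul]
    rw [hνv, hB m v, hmv]
    field_simp
    ring
  refine ⟨heq, ?_⟩
  have h2 : (1 : ℝ) = B ν m / r / r * B ν m := by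
    rw [← hν]
    conv_lhs => rw [heq]
    rw [hB, map_smul, smul_eq_mul, heq]
    simp only [map_smul, smul_apply, smul_eq_mul]
    rw [← hsq]
    field_simp
  rw [h2]
  field_simp

namespace PosSemidefMetric

variable {M : Type*} [TopologicalSpace M] [ChartedSpace Plane M]
  {φ : OpenPartialHomeomorph M Plane} {γ : ℝ → M}

lemma continuousOn_chartDeriv (hφ : φ ∈ IsManifold.maximalAtlas (𝓡 2) ∞ M)
    [IsManifold (𝓡 2) ∞ M]
    {n : Π t : ℝ, TangentSpace (𝓡 2) (γ t)} {T : Set ℝ}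
    (hn : ContinuousOn
      (fun t ↦ (TotalSpace.mk' Plane (γ t) (n t) : TangentBundle (𝓡 2) M)) T)
    (hT : ∀ t ∈ T, γ t ∈ φ.source) : ContinuousOn (fun t ↦ chartDeriv φ (γ t) (n t)) T := by
  have h1 : ContinuousOn (tangentMapWithin (𝓡 2) 𝓘(ℝ, Plane) φ φ.source)
      (TotalSpace.proj ⁻¹' φ.source) :=
    (contMDiffOn_of_mem_maximalAtlas hφ).continuousOn_tangentMapWithin (by simp)
      φ.open_source.uniqueMDiffOn
  have h2 := h1.comp hn hT
  have h3 : ContinuousOn (fun t ↦ (TotalSpace.mk' Plane (φ (γ t)) (chartDeriv φ (γ t) (n t)) :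
      TangentBundle 𝓘(ℝ, Plane) Plane)) T := by
    refine h2.congr fun t ht ↦ ?_
    simp only [Function.comp, tangentMapWithin]
    rw [mfderivWithin_of_isOpen φ.open_source (hT t ht)]
    rfl
  intro t ht
  have := (FiberBundle.continuousWithinAt_totalSpace Plane _).1 (h3 t ht)
  simpa using this.2

end PosSemidefMetric

/-- A vector parallel to the nonzero null vector f would itself be null, but B e e > 0. -/
lemma cross_ne_zero_of_null {B : Plane →L[ℝ] Plane →L[ℝ] ℝ} {e f : Plane} (hf0 : f ≠ 0)
    (hf : ∀ w, B f w = 0) (he : 0 < B e e) : cross e f ≠ 0 := by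
  intro h
  have hk : ∀ k, f k • e = e k • f := fun k ↦ by
    ext i
    unfold cross at h
    fin_cases k <;> fin_cases i <;> simp <;> linarith
  refine hf0 ?_
  ext k
  have h2 := congrArg (fun w ↦ B w e) (hk k)
  simpa [hf, he.ne'] using h2

lemma eventually_pos_of_second_deriv_pos {l : ℝ → ℝ} {δ : ℝ} (hδ : 0 < δ)
    (sl : ContDiffOn ℝ ∞ l (Ico 0 δ)) (h0 : l 0 = 0) (h1 : derivWithin l (Ico 0 δ) 0 = 0)
    (h2 : 0 < derivWithin (derivWithin l (Ico 0 δ)) (Ico 0 δ) 0) :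
    ∀ᶠ t in 𝓝[>] (0 : ℝ), 0 < l t := by
  have tl := sl.tendsto_nhdsGT hδ
  have tl' := sl.derivWithin_Ico.tendsto_nhdsGT hδ
  rw [h0] at tl
  rw [h1] at tl'
  have tl2 := tendsto_div_sq_of_hasDerivAt (sl.eventually_hasDerivAt_derivWithin hδ) tl
    (tendsto_div_id_of_hasDerivAt (sl.derivWithin_Ico.eventually_hasDerivAt_derivWithin hδ) tl'
      (sl.derivWithin_Ico.derivWithin_Ico.tendsto_nhdsGT hδ))
  filter_upwards [tl2.eventually_const_lt (by positivity : (0 : ℝ) < _), eventually_pos_nhdsGT]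
    with t ht ht0
  rwa [div_pos_iff_of_pos_right (by positivity)] at ht

/-! ### The geodesic curvature measure along the curve -/

namespace PosSemidefMetric

variable {M : Type*} [TopologicalSpace M] [ChartedSpace Plane M] [IsManifold (𝓡 2) ∞ M]
  (g : PosSemidefMetric M) {φ : OpenPartialHomeomorph M Plane} {γ : ℝ → M} {J T : Set ℝ} {t : ℝ}
  {n : Π t : ℝ, TangentSpace (𝓡 2) (γ t)}

lemma chartVelocity_ne_zero {M : Type*} [TopologicalSpace M] [ChartedSpace Plane M]
    {φ : OpenPartialHomeomorph M Plane} {γ : ℝ → M} {J : Set ℝ} {t : ℝ}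
    (hφ : φ ∈ IsManifold.maximalAtlas (𝓡 2) ∞ M)
    (hJ : UniqueDiffOn ℝ J) (hγ : ContMDiffWithinAt 𝓘(ℝ, ℝ) (𝓡 2) ∞ γ J t)
    (htJ : t ∈ J) (ht : γ t ∈ φ.source) (hv : velocity γ J t ≠ 0) :
    chartVelocity φ γ J t ≠ 0 := by
  intro h
  rw [chartVelocity_eq hφ hJ hγ htJ ht] at h
  have h2 := chartSymmDeriv_chartDeriv hφ ht (planeVelocity γ J t)
  rw [h, map_zero] at h2
  exact hv h2.symm

lemma chartForm_pos (hφ : φ ∈ IsManifold.maximalAtlas (𝓡 2) ∞ M) {q : M}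
    (hq : q ∈ φ.source) (hs : ¬ g.IsSingular q) {v : Plane} (hv : v ≠ 0) :
    0 < g.chartForm φ (φ q) v v := by
  refine (g.chartForm_nonneg _ v).lt_of_ne fun h ↦ hs ?_
  exact (g.isSingular_iff hφ hq).2 ⟨v, hv,
    null_of_apply_self_eq_zero (g.chartForm_symm _) (g.chartForm_nonneg _) h.symm⟩

lemma geodesicCurvature_mul_speed_eq (hφ : φ ∈ IsManifold.maximalAtlas (𝓡 2) ∞ M)
    (hJ : UniqueDiffOn ℝ J) (hγ : ContMDiffOn 𝓘(ℝ, ℝ) (𝓡 2) ∞ γ J)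
    (htJ : t ∈ J) (ht : γ t ∈ φ.source) (hs : ¬ g.IsSingular (γ t)) :
    g.geodesicCurvature γ J n t * g.speed γ J t =
      accelPairing (g.chartForm φ) (φ (γ t)) (chartVelocity φ γ J t) (chartAccel φ γ J t)
        (chartDeriv φ (γ t) (n t)) /
          √(g.chartForm φ (φ (γ t)) (chartVelocity φ γ J t) (chartVelocity φ γ J t)) := by
  unfold geodesicCurvature
  -- The cancellation a / s / s · s = a / s also holds for s = 0, because division by zero gives
  -- zero.
  rw [g.accelInner_eq hφ hJ hγ htJ ht hs, g.speed_eq hφ hJ (hγ t htJ) htJ ht, sq, ← div_div,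
    div_mul_cancel_of_imp]
  intro h
  rw [h, div_zero]

/-- Near t everything is rewritten in the single chart at γ t; the preferred chart in the definition
may change with the time. -/
lemma continuousWithinAt_geodesicCurvature_mul_speed
    (hJ : UniqueDiffOn ℝ J) (hγ : ContMDiffOn 𝓘(ℝ, ℝ) (𝓡 2) ∞ γ J)
    (hreg : ∀ t ∈ J, velocity γ J t ≠ 0) (hTJ : T ⊆ J) (hTs : ∀ t ∈ T, ¬ g.IsSingular (γ t))
    (hn : ContinuousOn (fun t ↦ (TotalSpace.mk' Plane (γ t) (n t) : TangentBundle (𝓡 2) M)) T)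
    (ht : t ∈ T) :
    ContinuousWithinAt (fun s ↦ g.geodesicCurvature γ J n s * g.speed γ J s) T t := by
  obtain ⟨φ, hφ, hq⟩ : ∃ φ ∈ IsManifold.maximalAtlas (𝓡 2) ∞ M, γ t ∈ φ.source :=
    ⟨chartAt Plane (γ t), IsManifold.chart_mem_maximalAtlas _, mem_chart_source Plane (γ t)⟩
  have htJ := hTJ ht
  have hsrc : ∀ᶠ s in 𝓝[T] t, γ s ∈ φ.source :=
    (eventually_mem_source (hγ t htJ) hq).filter_mono (nhdsWithin_mono t hTJ)
  have cx : ContinuousWithinAt (fun s ↦ φ (γ s)) T t :=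
    (contDiffWithinAt_chart_comp hφ (hγ t htJ) hq).continuousWithinAt.mono hTJ
  have cv : ContinuousWithinAt (chartVelocity φ γ J) T t :=
    (contDiffWithinAt_chartVelocity hφ hJ (hγ t htJ) htJ hq).continuousWithinAt.mono hTJ
  have ca : ContinuousWithinAt (chartAccel φ γ J) T t :=
    (contDiffWithinAt_chartAccel hφ hJ (hγ t htJ) htJ hq).continuousWithinAt.mono hTJ
  have cν : ContinuousWithinAt (fun s ↦ chartDeriv φ (γ s) (n s)) T t := by
    have h := continuousOn_chartDeriv hφ (hn.mono (inter_subset_left (t := γ ⁻¹' φ.source)))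
      (fun s hs ↦ hs.2) t ⟨ht, hq⟩
    exact h.mono_of_mem_nhdsWithin (inter_mem self_mem_nhdsWithin hsrc)
  have cG : ContinuousWithinAt (fun s ↦ g.chartForm φ (φ (γ s))) T t :=
    ((g.contDiffOn_chartForm hφ).continuousOn.continuousAt
      (φ.open_target.mem_nhds (φ.map_source hq))).comp_continuousWithinAt (f := fun s ↦ φ (γ s)) cx
  have cA := continuousWithinAt_accelPairing φ.open_target (g.contDiffOn_chartForm hφ) cx
    (φ.map_source hq) cv ca cν
  have hpos := g.chartForm_pos hφ hq (hTs t ht)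
    (chartVelocity_ne_zero hφ hJ (hγ t htJ) htJ hq (hreg t htJ))
  refine (cA.div (cG.clm_clm_apply cv cv).sqrt (Real.sqrt_pos.2 hpos).ne').congr_of_eventuallyEq
    ?_ (g.geodesicCurvature_mul_speed_eq hφ hJ hγ htJ hq (hTs t ht))
  filter_upwards [hsrc, self_mem_nhdsWithin] with s hs hsT
  exact g.geodesicCurvature_mul_speed_eq hφ hJ hγ (hTJ hsT) hs (hTs s hsT)

/-- λ has a minimum at the singular point, so its gradient vanishes there. This kills the first
derivative along the curve and the acceleration term of the second, leaving the Hessian in the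
direction of the velocity. -/
lemma gramDet_curve_derivWithin {x : ℝ → Plane} {δ : ℝ} (hδ : 0 < δ)
    (hφ : φ ∈ IsManifold.maximalAtlas (𝓡 2) ∞ M) (hx : ContDiffOn ℝ ∞ x (Ico 0 δ))
    (hxU : MapsTo x (Ico 0 δ) φ.target) (h0 : g.gramDet φ (x 0) = 0) (e f : Plane) :
    derivWithin (fun t ↦ gram (g.chartForm φ (x t)) e f) (Ico 0 δ) 0 = 0 ∧
    derivWithin (derivWithin (fun t ↦ gram (g.chartForm φ (x t)) e f) (Ico 0 δ)) (Ico 0 δ) 0 =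
      cross e f ^ 2 * fderiv ℝ (fderiv ℝ (g.gramDet φ)) (x 0) (derivWithin x (Ico 0 δ) 0)
        (derivWithin x (Ico 0 δ) 0) := by
  have h0J : (0 : ℝ) ∈ Ico 0 δ := ⟨le_rfl, hδ⟩
  have hmin : fderiv ℝ (g.gramDet φ) (x 0) = 0 :=
    IsLocalMin.fderiv_eq_zero (Eventually.of_forall fun y ↦ by rw [h0]; exact g.gramDet_nonneg y)
  have hd : ∀ t ∈ Ico 0 δ, HasDerivWithinAt x (derivWithin x (Ico 0 δ) t) (Ico 0 δ) t :=
    fun t ht ↦ ((hx.differentiableOn (by simp)) t ht).hasDerivWithinAt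
  have h1 : ∀ t ∈ Ico 0 δ, derivWithin (fun t ↦ gram (g.chartForm φ (x t)) e f) (Ico 0 δ) t =
      cross e f ^ 2 * fderiv ℝ (g.gramDet φ) (x t) (derivWithin x (Ico 0 δ) t) := by
    intro t ht
    simp only [gram_chartForm]
    exact ((((g.contDiffAt_gramDet hφ (hxU ht)).differentiableAt
      (by simp)).hasFDerivAt.comp_hasDerivWithinAt t (hd t ht)).const_mul _).derivWithin
        (uniqueDiffOn_Ico 0 δ t ht)
  refine ⟨by rw [h1 0 h0J, hmin]; simp, ?_⟩
  rw [derivWithin_congr h1 (h1 0 h0J)]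
  have hD : DifferentiableAt ℝ (fderiv ℝ (g.gramDet φ)) (x 0) :=
    ((g.contDiffAt_gramDet hφ (hxU h0J)).fderiv_right (m := 1) (by norm_cast)).differentiableAt
      (by simp)
  have h2 := ((hd 0 h0J).clm_comp_apply hD
    (((hx.derivWithin_Ico.differentiableOn (by simp)) 0 h0J).hasDerivWithinAt)).const_mul
      (cross e f ^ 2)
  rw [h2.derivWithin (uniqueDiffOn_Ico 0 δ 0 h0J), hmin]
  simp

/-- Near an intrinsic cross cap, a regular curve meets no further singular point, and its geodesic
curvature measure has a limit. -/
lemma exists_tendsto_geodesicCurvature_mul_speed (hg : g.Admissible) {p : M}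
    (hp : g.IsIntrinsicCrossCap p) {ε : ℝ} (hε : 0 < ε) (hγ0 : γ 0 = p)
    (hγ : ContMDiffOn 𝓘(ℝ, ℝ) (𝓡 2) ∞ γ (Ico 0 ε))
    (hγreg : ∀ t ∈ Ico 0 ε, velocity γ (Ico 0 ε) t ≠ 0)
    (hn : g.IsUnitNormalOn γ (Ico 0 ε) n (g.regularTimes γ ε)) :
    (∀ᶠ t in 𝓝[>] (0 : ℝ), t ∈ g.regularTimes γ ε) ∧
    ∃ L, Tendsto (fun t ↦ g.geodesicCurvature γ (Ico 0 ε) n t * g.speed γ (Ico 0 ε) t)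
      (𝓝[>] 0) (𝓝 L) := by
  obtain ⟨hsing, φ, hφ, hpφ, hdet⟩ := hp
  subst hγ0
  have hJ := uniqueDiffOn_Ico (0 : ℝ) ε
  have h0J : (0 : ℝ) ∈ Ico 0 ε := ⟨le_rfl, hε⟩
  have h0 : g.gramDet φ (φ (γ 0)) = 0 := (g.isSingular_iff_gramDet hφ hpφ).1 hsing
  have hH : ∀ v, v ≠ 0 → 0 < fderiv ℝ (fderiv ℝ (g.gramDet φ)) (φ (γ 0)) v v := fun v hv ↦
    fderiv_fderiv_pos (g.contDiffAt_gramDet hφ (φ.map_source hpφ)) g.gramDet_nonneg h0 hdet hv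
  obtain ⟨e, he⟩ := g.exists_chartForm_pos hg hφ hpφ hH h0
  obtain ⟨f, hf0, hf⟩ := (g.isSingular_iff hφ hpφ).1 hsing
  have hef : cross e f ≠ 0 := cross_ne_zero_of_null hf0 hf he
  obtain ⟨δ, hδ, hδε, hsrc⟩ : ∃ δ, 0 < δ ∧ δ ≤ ε ∧ ∀ t ∈ Ico 0 δ, γ t ∈ φ.source := by
    have h := eventually_mem_source (hγ 0 h0J) hpφ
    rw [nhdsWithin_Ico_eq_nhdsGE hε] at h
    obtain ⟨δ, hδ, hsub⟩ := mem_nhdsGE_iff_exists_Ico_subset.1 h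
    exact ⟨min δ ε, lt_min hδ hε, min_le_right _ _,
      fun t ht ↦ hsub ⟨ht.1, ht.2.trans_le (min_le_left _ _)⟩⟩
  have hsub : Ico 0 δ ⊆ Ico 0 ε := Ico_subset_Ico_right hδε
  have hx : ContDiffOn ℝ ∞ (fun t ↦ φ (γ t)) (Ico 0 δ) := fun t ht ↦
    (contDiffWithinAt_chart_comp hφ (hγ t (hsub ht)) (hsrc t ht)).mono hsub
  have hxU : MapsTo (fun t ↦ φ (γ t)) (Ico 0 δ) φ.target := fun t ht ↦ φ.map_source (hsrc t ht)
  -- Shortening the interval to stay in the chart does not change one-sided derivatives, as both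
  -- intervals agree near each of these times, including 0.
  have hset : ∀ t ∈ Ico 0 δ, Ico 0 δ =ᶠ[𝓝 t] Ico 0 ε := by
    intro t ht
    filter_upwards [Iio_mem_nhds ht.2] with s hs
    exact propext ⟨fun h ↦ hsub h, fun h ↦ ⟨h.1, hs⟩⟩
  have hvel : ∀ t ∈ Ico 0 δ, derivWithin (fun t ↦ φ (γ t)) (Ico 0 δ) t =
      chartVelocity φ γ (Ico 0 ε) t := fun t ht ↦ derivWithin_congr_set (hset t ht)
  have hacc : ∀ t ∈ Ico 0 δ, derivWithin (derivWithin (fun t ↦ φ (γ t)) (Ico 0 δ)) (Ico 0 δ) t =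
      chartAccel φ γ (Ico 0 ε) t := fun t ht ↦ by
    rw [derivWithin_congr hvel (hvel t ht), derivWithin_congr_set (hset t ht)]
    rfl
  have h0δ : (0 : ℝ) ∈ Ico 0 δ := ⟨le_rfl, hδ⟩
  have hv0 : derivWithin (fun t ↦ φ (γ t)) (Ico 0 δ) 0 ≠ 0 := by
    rw [hvel 0 h0δ]
    exact chartVelocity_ne_zero hφ hJ (hγ 0 h0J) h0J hpφ (hγreg 0 h0J)
  obtain ⟨hl1, hl2⟩ := g.gramDet_curve_derivWithin hδ hφ hx hxU h0 e f
  have hl2pos : 0 < derivWithin (derivWithin (fun t ↦ gram (g.chartForm φ (φ (γ t))) e f)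
      (Ico 0 δ)) (Ico 0 δ) 0 := by
    rw [hl2]
    have := hH _ hv0
    positivity
  have hreg : ∀ᶠ t in 𝓝[>] (0 : ℝ), t ∈ g.regularTimes γ ε := by
    have sG : ∀ a b, ContDiffOn ℝ ∞ (fun t ↦ g.chartForm φ (φ (γ t)) a b) (Ico 0 δ) := fun a b ↦
      ((g.contDiffOn_chartForm hφ).comp_curve hx hxU).clm_clm_apply contDiffOn_const
        contDiffOn_const
    have hpos := eventually_pos_of_second_deriv_pos hδ
      (((sG e e).mul (sG f f)).sub ((sG e f).pow 2))
      (by simp [g.chartForm_symm _ e f, hf]) hl1 hl2pos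
    filter_upwards [hpos, Ioo_mem_nhdsGT hδ] with t ht htδ
    refine ⟨⟨htδ.1, htδ.2.trans_le hδε⟩, fun hsg ↦ ?_⟩
    have h1 := (g.isSingular_iff_gramDet hφ (hsrc t (Ioo_subset_Ico_self htδ))).1 hsg
    have h2 := g.gram_chartForm (φ := φ) (φ (γ t)) e f
    rw [h1, mul_zero] at h2
    exact ht.ne' h2
  refine ⟨hreg, ?_⟩
  obtain ⟨L, hL⟩ := exists_tendsto_accelPairing φ.open_target (g.contDiffOn_chartForm hφ)
    g.chartForm_symm hδ hx hxU hef he hf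
    (g.christoffelFirst_chartForm_eq_zero hg hφ hpφ hf0 hf) hl1 hl2pos hv0 rfl rfl
  obtain ⟨η, hη, hηsub⟩ := mem_nhdsGT_iff_exists_Ioo_subset.1
    (inter_mem hreg (Ioo_mem_nhdsGT hδ))
  set x : ℝ → Plane := fun t ↦ φ (γ t)
  set G := g.chartForm φ with hGdef
  set v := chartVelocity φ γ (Ico 0 ε) with hvdef
  set ν : ℝ → Plane := fun t ↦ chartDeriv φ (γ t) (n t)
  set m : ℝ → Plane := fun t ↦ -(G (x t) (v t) f) • e + G (x t) (v t) e • f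
  -- The inner product of the given normal with the normalized rotation m of the velocity; it takes
  -- only the values ±1.
  set σ : ℝ → ℝ := fun t ↦ G (x t) (ν t) (m t) / (√(gram (G (x t)) e f) * √(G (x t) (v t) (v t)))
  have hR : ∀ t ∈ Ioo 0 η, t ∈ Ico 0 δ ∧ t ∈ Ico 0 ε ∧ γ t ∈ φ.source ∧ ¬ g.IsSingular (γ t) ∧
      v t ≠ 0 ∧ 0 < gram (G (x t)) e f ∧ t ∈ g.regularTimes γ ε := by
    intro t ht
    obtain ⟨h1, h2⟩ := hηsub ht
    have hδt := Ioo_subset_Ico_self h2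
    have hεt := hsub hδt
    have hs := hsrc t hδt
    refine ⟨hδt, hεt, hs, h1.2, chartVelocity_ne_zero hφ hJ (hγ t hεt) hεt hs (hγreg t hεt), ?_, h1⟩
    rw [hGdef, gram_chartForm]
    have := (g.gramDet_nonneg (φ := φ) (x t)).lt_of_ne
      (fun h ↦ h1.2 ((g.isSingular_iff_gramDet hφ hs).2 h.symm))
    positivity
  have hform : ∀ t ∈ Ioo 0 η, ν t =
      (σ t / (√(gram (G (x t)) e f) * √(G (x t) (v t) (v t)))) • m t ∧ σ t ^ 2 = 1 := by
    intro t ht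
    obtain ⟨hδt, hεt, hs, hns, hvt, hgt, hrt⟩ := hR t ht
    have he0 : e ≠ 0 := by rintro rfl; simp at he
    refine eq_smul_rotation (g.chartForm_symm _) hef (g.chartForm_pos hφ hs hns he0) hgt hvt
      ?_ ?_ rfl
    · exact (g.chartForm_chartDeriv hφ hs _ _).trans (hn.unit t hrt)
    · rw [hvdef, chartVelocity_eq hφ hJ (hγ t hεt) hεt hs]
      exact (g.chartForm_chartDeriv hφ hs _ _).trans (hn.orthogonal t hrt)
  have hσ : ContinuousOn σ (Ioo 0 η) := by
    have hcν : ContinuousOn ν (Ioo 0 η) :=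
      continuousOn_chartDeriv hφ (hn.continuousOn.mono fun t ht ↦ (hR t ht).2.2.2.2.2.2)
        fun t ht ↦ (hR t ht).2.2.1
    intro t ht
    obtain ⟨hδt, hεt, hs, hns, hvt, hgt, hrt⟩ := hR t ht
    have hsubη : Ioo 0 η ⊆ Ico 0 ε := fun s hs ↦ (hR s hs).2.1
    have cv : ContinuousWithinAt v (Ioo 0 η) t :=
      (contDiffWithinAt_chartVelocity hφ hJ (hγ t hεt) hεt hs).continuousWithinAt.mono hsubη
    have cG : ContinuousWithinAt (fun s ↦ G (x s)) (Ioo 0 η) t :=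
      (((g.contDiffOn_chartForm hφ).comp_curve hx hxU).continuousOn t hδt).mono
        fun s hs ↦ (hR s hs).1
    have cGc : ∀ a b, ContinuousWithinAt (fun s ↦ G (x s) a b) (Ioo 0 η) t := fun a b ↦
      cG.clm_clm_apply continuousWithinAt_const continuousWithinAt_const
    have cm : ContinuousWithinAt m (Ioo 0 η) t :=
      ((cG.clm_clm_apply cv continuousWithinAt_const).neg.smul continuousWithinAt_const).add
        ((cG.clm_clm_apply cv continuousWithinAt_const).smul continuousWithinAt_const)
    have cl : ContinuousWithinAt (fun s ↦ gram (G (x s)) e f) (Ioo 0 η) t :=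
      ((cGc e e).mul (cGc f f)).sub ((cGc e f).pow 2)
    have hN : 0 < G (x t) (v t) (v t) := g.chartForm_pos hφ hs hns hvt
    exact (cG.clm_clm_apply (hcν t ht) cm).div (cl.sqrt.mul (cG.clm_clm_apply cv cv).sqrt)
      (by positivity)
  -- A continuous function with square 1 on an interval is constant, so the choice of normal only
  -- multiplies the limit by a fixed sign.
  obtain ⟨c, hc⟩ : ∃ c, ∀ t ∈ Ioo 0 η, σ t = c := by
    rcases isPreconnected_Ioo.eq_or_eq_neg_of_sq_eq hσ (g := 1) continuousOn_const
      (fun t ht ↦ by simpa using (hform t ht).2) (by simp) with h | h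
    · exact ⟨1, fun t ht ↦ h ht⟩
    · exact ⟨-1, fun t ht ↦ h ht⟩
  refine ⟨c * L, (hL.const_mul c).congr' ?_⟩
  filter_upwards [Ioo_mem_nhdsGT hη] with t ht
  obtain ⟨hδt, hεt, hs, hns, hvt, hgt, hrt⟩ := hR t ht
  have hN : 0 < G (x t) (v t) (v t) := g.chartForm_pos hφ hs hns hvt
  rw [g.geodesicCurvature_mul_speed_eq hφ hJ hγ hεt hs hns, hvel t hδt, hacc t hδt]
  change c * (accelPairing G (x t) (v t) _ (m t) / (√(gram (G (x t)) e f) * G (x t) (v t) (v t))) =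
    accelPairing G (x t) (v t) _ (ν t) / _
  rw [(hform t ht).1, accelPairing_smul, hc t ht]
  have hr := Real.sq_sqrt hN.le
  have hrpos := Real.sqrt_pos.2 hN
  have hgpos := Real.sqrt_pos.2 hgt
  change _ = _ / √(G (x t) (v t) (v t))
  generalize √(G (x t) (v t) (v t)) = r at *
  rw [← hr]
  field_simp

end PosSemidefMetric

end

theorem theorem3p1 {M : Type*} [TopologicalSpace M] [ChartedSpace Plane M]
    [IsManifold (𝓡 2) ∞ M] (g : PosSemidefMetric M) (hg : g.Admissible)
    (p : M) (hp : g.IsIntrinsicCrossCap p)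
    (ε : ℝ) (hε : 0 < ε) (γ : ℝ → M) (hγ0 : γ 0 = p)
    (hγ : ContMDiffOn 𝓘(ℝ, ℝ) (𝓡 2) ∞ γ (Ico 0 ε))
    (hγreg : ∀ t ∈ Ico 0 ε, PosSemidefMetric.velocity γ (Ico 0 ε) t ≠ 0)
    (n : Π t : ℝ, TangentSpace (𝓡 2) (γ t))
    (hn : g.IsUnitNormalOn γ (Ico 0 ε) n (g.regularTimes γ ε)) :
    (∀ᶠ t in 𝓝[>] (0 : ℝ), t ∈ g.regularTimes γ ε) ∧
    ∃ f : ℝ → ℝ, ContinuousOn f (insert 0 (g.regularTimes γ ε)) ∧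
      ∀ t ∈ g.regularTimes γ ε,
        f t = g.geodesicCurvature γ (Ico 0 ε) n t * g.speed γ (Ico 0 ε) t := by
  obtain ⟨hreg, L, hL⟩ := g.exists_tendsto_geodesicCurvature_mul_speed hg hp hε hγ0 hγ hγreg hn
  -- The value at 0 is replaced by the limit, since the formula has no meaning at the singular
  -- point.
  refine ⟨hreg, Function.update
    (fun t ↦ g.geodesicCurvature γ (Ico 0 ε) n t * g.speed γ (Ico 0 ε) t) 0 L, ?_, ?_⟩
  · rintro t (rfl | ht)
    · rw [continuousWithinAt_update_same]
      refine hL.mono_left (nhdsWithin_mono _ ?_)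
      rintro s ⟨rfl | hs, hs0⟩
      · exact absurd rfl hs0
      · exact hs.1.1
    · have ht0 : t ≠ 0 := ht.1.1.ne'
      rw [continuousWithinAt_update_of_ne ht0]
      unfold ContinuousWithinAt
      -- Away from 0 the inserted point is irrelevant, and continuity is that on the regular times.
      rw [nhdsWithin_insert_of_ne ht0]
      exact g.continuousWithinAt_geodesicCurvature_mul_speed (uniqueDiffOn_Ico 0 ε) hγ hγreg
        (fun s hs ↦ Ioo_subset_Ico_self hs.1) (fun s hs ↦ hs.2) hn.continuousOn ht
  · intro t ht
    exact Function.update_of_ne ht.1.1.ne' _ _
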